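/- Let $\eta>0$, $\alpha\in(1/2,1)$, $\sigma>0$ and $C_\eta>1/\eta$ be fixed. Let $\xi_1,\xi_2,\dots$ be i.i.d. Gaussian random variables with mean $x^*=0$ and variance $\sigma$, and consider the SGD iterates for one-dimensional mean estimation $$x_0=0,\qquad x_i=x_{i-1}-\eta_i\,(x_{i-1}-\xi_i),\qquad \eta_i=\eta\, i^{-\alpha}\quad(i\ge 1).$$ Put $\ell_i=\lfloor C_\eta\, i^{\alpha}\log i\rfloor$ and let $$\hat\sigma_n=\frac1n\sum_{i=1}^n\Big[2x_i\sum_{k=\max(1,\,i-\ell_i+1)}^{i}x_k-x_i^2\Big]$$ be the oracle de-biased estimator of $\sigma$, where a sum over an empty range is $0$. Then $\mathbb E(\hat\sigma_n-\sigma)^2\asymp n^{\alpha-1}\log n$; that is, there are constants $c_1,c_2>0$, depending only on $\eta,\alpha,C_\eta,\sigma$, such that for every $n\ge 2$ $$c_1\,n^{\alpha-1}\log n\;\le\;\mathbb E(\hat\sigma_n-\sigma)^2\;\le\;c_2\,n^{\alpha-1}\log n .$$ -/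

import Mathlib

open MeasureTheory ProbabilityTheory
open scoped NNReal

/-- The SGD iterates for the squared loss `f(x, ξ) = (ξ - x)² / 2` with step sizes
`η_i = η * i ^ (-α)`, started at `x_0 = 0` and driven by the data `ξ 1, ξ 2, …`:
`x_i = x_{i-1} - η_i (x_{i-1} - ξ_i)` for `i ≥ 1`. -/
noncomputable def sgdIterate (η α : ℝ) (ξ : ℕ → ℝ) : ℕ → ℝ
  | 0 => 0
  | i + 1 => sgdIterate η α ξ i
      - η * ((i + 1 : ℕ) : ℝ) ^ (-α) * (sgdIterate η α ξ i - ξ (i + 1))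

/-- The batch size `ℓ_i = C i ^ α log i`, rounded down to an integer. -/
noncomputable def batchSize (C α : ℝ) (i : ℕ) : ℕ :=
  ⌊C * (i : ℝ) ^ α * Real.log i⌋₊

/-- The oracle de-biased estimator
`(1 / n) ∑_{i=1}^n [2 x_i (∑_{k=i-ℓ_i+1}^i x_k) - x_i²]` of a sequence `x` with batch sizes `ℓ`.
The subtraction `i - ℓ i` is truncated at `0`, so a batch that would start before the first
iterate consists of all of `x_1, …, x_i`. -/
noncomputable def oracleEstimator (x : ℕ → ℝ) (ℓ : ℕ → ℕ) (n : ℕ) : ℝ :=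
  (1 / (n : ℝ)) * ∑ i ∈ Finset.Icc 1 n,
    (2 * x i * (∑ k ∈ Finset.Ioc (i - ℓ i) i, x k) - x i ^ 2)

/-! Each iterate is linear in the data, so the estimator is a quadratic form `(1/n) ∑ M a b ξ_{a+1}
ξ_{b+1}` in independent centred Gaussians, with `M = oracleForm`. By Isserlis' formula its mean
squared error is exactly `σ² / n²` times `(tr M - n)² + ‖M + Mᵀ‖² / 2`, in the Frobenius norm
(`integral_sq_quadForm_sub`, `oracleMSE_eq`). The rest is deterministic.

Bias: `tr M - n = O(n^α)`. The recursions for variances and covariance sums turn the untruncated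
part into increments divided by step sizes, and summation by parts leaves a boundary term of order
`1 / η_n`. The covariances cut off by the batch at `i` are `O(1 / i)`, because `C > 1 / η`. The
squared bias `n^(2α)` is dominated by `n^(1+α) log n`.

Variance: `‖M + Mᵀ‖²` has order `n^(1+α) log n`. From above, the entries of `M` are bounded and
their absolute sum is `O(∑ (ℓ_i + 1))` (`sum_sq_oracleForm_le`). From below, about `n` indices `b`,
each with about `n^α log n` indices `a`, give entries of `M + Mᵀ` bounded away from zero
(`le_sum_sq_oracleForm`). -/

/-! ### Gaussian moments and quadratic forms -/

lemma integral_pow_four_gaussianReal (v : ℝ≥0) :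
    ∫ x, x ^ 4 ∂(gaussianReal 0 v) = 3 * (v : ℝ) ^ 2 := by
  have key : ∀ p q : ℝ → ℝ, (∀ t, HasDerivAt p (q t) t) →
      deriv (fun t => p t * Real.exp (v * t ^ 2 / 2))
        = fun t => (q t + p t * (v * t)) * Real.exp (v * t ^ 2 / 2) := by
    intro p q hpq
    ext t
    have h1 : HasDerivAt (fun t : ℝ => (v : ℝ) * t ^ 2 / 2) (v * t) t :=
      (((hasDerivAt_pow 2 t).const_mul (v : ℝ)).div_const 2).congr_deriv (by norm_num; ring)
    rw [((hpq t).fun_mul h1.exp).deriv]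
    ring
  have h := iteratedDeriv_mgf_zero (X := id) (μ := gaussianReal 0 v) (by simp) 4
  have e : mgf id (gaussianReal 0 v) = fun t => (1 : ℝ) * Real.exp (v * t ^ 2 / 2) := by
    rw [mgf_id_gaussianReal]; simp
  -- The coefficients stay unsimplified to match syntactically what `key` produces, so that it can
  -- be applied four times.
  have h1 : ∀ t : ℝ, HasDerivAt (fun t : ℝ => 0 + 1 * ((v : ℝ) * t)) v t := fun t => by
    simpa using (hasDerivAt_id t).const_mul (v : ℝ)
  have h2 : ∀ t : ℝ, HasDerivAt (fun t : ℝ => (v : ℝ) + (0 + 1 * (v * t)) * (v * t))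
      (0 + (v * (v * t) + (0 + 1 * (v * t)) * v)) t := fun t => by
    have h3 : HasDerivAt (fun t : ℝ => (v : ℝ) * t) v t := by
      simpa using (hasDerivAt_id t).const_mul (v : ℝ)
    simpa using ((h1 t).fun_mul h3).const_add (v : ℝ)
  have h3 : ∀ t : ℝ, HasDerivAt (fun t : ℝ => 0 + ((v : ℝ) * (v * t) + (0 + 1 * (v * t)) * v)
      + (v + (0 + 1 * (v * t)) * (v * t)) * (v * t))
      (0 + (v * v + v * v) + ((0 + (v * (v * t) + (0 + 1 * (v * t)) * v)) * (v * t)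
        + (v + (0 + 1 * (v * t)) * (v * t)) * v)) t := fun t => by
    have h4 : HasDerivAt (fun t : ℝ => (v : ℝ) * t) v t := by
      simpa using (hasDerivAt_id t).const_mul (v : ℝ)
    exact (((h4.const_mul (v : ℝ)).add ((h1 t).mul_const (v : ℝ))).const_add 0
      |>.fun_add ((h2 t).fun_mul h4)).congr_deriv (by ring)
  rw [e, iteratedDeriv_succ, iteratedDeriv_succ, iteratedDeriv_succ, iteratedDeriv_one,
    key _ (fun _ => 0) (fun t => hasDerivAt_const t 1), key _ _ h1, key _ _ h2, key _ _ h3] at h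
  simp only [Pi.pow_apply, id] at h
  rw [← h]
  simp
  ring

section GaussianFamily

variable {ι Ω : Type*} [MeasurableSpace Ω] {P : Measure Ω} {X : ι → Ω → ℝ} {v : ℝ≥0}

lemma memLp_of_hasLaw_gaussianReal {Y : Ω → ℝ} (h : HasLaw Y (gaussianReal 0 v) P)
    (p : ENNReal) (hp : p ≠ ⊤) : MemLp Y p P := by
  have := memLp_id_gaussianReal' (μ := 0) (v := v) p hp
  rw [← h.map_eq] at this
  exact this.comp_of_map h.aemeasurable

lemma integral_of_hasLaw_gaussianReal {Y : Ω → ℝ} (h : HasLaw Y (gaussianReal 0 v) P) :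
    ∫ ω, Y ω ∂P = 0 := by
  rw [h.integral_eq, integral_id_gaussianReal]

lemma integral_sq_of_hasLaw_gaussianReal {Y : Ω → ℝ} (h : HasLaw Y (gaussianReal 0 v) P) :
    ∫ ω, Y ω ^ 2 ∂P = v := by
  have h1 := h.integral_comp (f := fun x : ℝ => x ^ 2) (by fun_prop)
  have h2 := variance_of_integral_eq_zero (X := fun x : ℝ => x) (μ := gaussianReal 0 v)
    (by fun_prop) (by simp)
  rw [variance_fun_id_gaussianReal] at h2
  rw [h2]
  exact h1

lemma integral_pow_four_of_hasLaw_gaussianReal {Y : Ω → ℝ} (h : HasLaw Y (gaussianReal 0 v) P) :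
    ∫ ω, Y ω ^ 4 ∂P = 3 * (v : ℝ) ^ 2 := by
  have h1 := h.integral_comp (f := fun x : ℝ => x ^ 4) (by fun_prop)
  rw [← integral_pow_four_gaussianReal]
  exact h1

lemma integral_mul_gaussian_family [DecidableEq ι] (hi : iIndepFun X P)
    (hX : ∀ i, HasLaw (X i) (gaussianReal 0 v) P) (a b : ι) :
    ∫ ω, X a ω * X b ω ∂P = if a = b then (v : ℝ) else 0 := by
  split_ifs with h
  · subst h
    simp_rw [← sq]
    exact integral_sq_of_hasLaw_gaussianReal (hX a)
  · rw [(hi.indepFun h).integral_fun_mul_eq_mul_integral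
      (hX a).aemeasurable.aestronglyMeasurable (hX b).aemeasurable.aestronglyMeasurable,
      integral_of_hasLaw_gaussianReal (hX a), zero_mul]

/-- An index that occurs only once splits off as an independent factor of mean zero; `b`, `c`, `d`
may coincide. -/
lemma integral_mul_four_eq_zero (hi : iIndepFun X P)
    (hX : ∀ i, HasLaw (X i) (gaussianReal 0 v) P) {a b c d : ι}
    (hb : a ≠ b) (hc : a ≠ c) (hd : a ≠ d) :
    ∫ ω, X a ω * (X b ω * X c ω * X d ω) ∂P = 0 := by
  classical
  have hm : ∀ i, AEMeasurable (X i) P := fun i => (hX i).aemeasurable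
  have h := hi.indepFun_finset₀ {a} {b, c, d} (by simp [hb, hc, hd]) hm
  have h2 : IndepFun (X a) (fun ω => X b ω * X c ω * X d ω) P :=
    h.comp (φ := fun f : ({a} : Finset ι) → ℝ => f ⟨a, by simp⟩)
      (ψ := fun f : ({b, c, d} : Finset ι) → ℝ =>
        f ⟨b, by simp⟩ * f ⟨c, by simp⟩ * f ⟨d, by simp⟩)
      (by fun_prop) (by fun_prop)
  rw [h2.integral_fun_mul_eq_mul_integral (hm a).aestronglyMeasurable
    (((hm b).mul (hm c)).mul (hm d)).aestronglyMeasurable,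
    integral_of_hasLaw_gaussianReal (hX a), zero_mul]

lemma integral_sq_mul_sq (hi : iIndepFun X P)
    (hX : ∀ i, HasLaw (X i) (gaussianReal 0 v) P) {a b : ι} (h : a ≠ b) :
    ∫ ω, X a ω ^ 2 * X b ω ^ 2 ∂P = (v : ℝ) ^ 2 := by
  have h2 : IndepFun (fun ω => X a ω ^ 2) (fun ω => X b ω ^ 2) P :=
    (hi.indepFun h).comp (φ := fun x => x ^ 2) (ψ := fun x => x ^ 2) (by fun_prop) (by fun_prop)
  rw [h2.integral_fun_mul_eq_mul_integral
    ((hX a).aemeasurable.pow_const 2).aestronglyMeasurable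
    ((hX b).aemeasurable.pow_const 2).aestronglyMeasurable,
    integral_sq_of_hasLaw_gaussianReal (hX a), integral_sq_of_hasLaw_gaussianReal (hX b), sq]

/-- Isserlis' formula for the fourth moments of independent centred Gaussians. -/
lemma integral_mul_four_gaussian_family [DecidableEq ι] (hi : iIndepFun X P)
    (hX : ∀ i, HasLaw (X i) (gaussianReal 0 v) P) (a b c d : ι) :
    ∫ ω, (X a ω * X b ω) * (X c ω * X d ω) ∂P =
      (v : ℝ) ^ 2 * ((if a = b ∧ c = d then 1 else 0) + (if a = c ∧ b = d then 1 else 0)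
        + (if a = d ∧ b = c then 1 else 0)) := by
  -- Either some index occurs exactly once and the moment vanishes, or the indices pair up.
  by_cases hab : a = b
  · subst hab
    by_cases hcd : c = d
    · subst hcd
      by_cases hac : a = c
      · subst hac
        have : ∀ ω, (X a ω * X a ω) * (X a ω * X a ω) = X a ω ^ 4 := fun ω => by ring
        simp_rw [this, integral_pow_four_of_hasLaw_gaussianReal (hX a)]
        simp
        ring
      · have : ∀ ω, (X a ω * X a ω) * (X c ω * X c ω) = X a ω ^ 2 * X c ω ^ 2 :=
          fun ω => by ring
        simp_rw [this, integral_sq_mul_sq hi hX hac]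
        simp [hac]
    · by_cases hac : a = c
      · subst hac
        have : ∀ ω, (X a ω * X a ω) * (X a ω * X d ω) = X d ω * (X a ω * X a ω * X a ω) :=
          fun ω => by ring
        simp_rw [this, integral_mul_four_eq_zero hi hX (Ne.symm hcd) (Ne.symm hcd) (Ne.symm hcd)]
        simp [hcd]
      · have : ∀ ω, (X a ω * X a ω) * (X c ω * X d ω) = X c ω * (X a ω * X a ω * X d ω) :=
          fun ω => by ring
        simp_rw [this, integral_mul_four_eq_zero hi hX (Ne.symm hac) (Ne.symm hac) hcd]
        simp [hcd, hac]
  · by_cases hac : a = c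
    · subst hac
      by_cases hbd : b = d
      · subst hbd
        have : ∀ ω, (X a ω * X b ω) * (X a ω * X b ω) = X a ω ^ 2 * X b ω ^ 2 :=
          fun ω => by ring
        simp_rw [this, integral_sq_mul_sq hi hX hab]
        simp [hab]
      · have : ∀ ω, (X a ω * X b ω) * (X a ω * X d ω) = X b ω * (X a ω * X a ω * X d ω) :=
          fun ω => by ring
        simp_rw [this, integral_mul_four_eq_zero hi hX (Ne.symm hab) (Ne.symm hab) hbd]
        simp [hab, hbd, Ne.symm hab]
    · by_cases had : a = d
      · subst had
        by_cases hbc : b = c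
        · subst hbc
          have : ∀ ω, (X a ω * X b ω) * (X b ω * X a ω) = X a ω ^ 2 * X b ω ^ 2 :=
            fun ω => by ring
          simp_rw [this, integral_sq_mul_sq hi hX hab]
          simp [hab]
        · have : ∀ ω, (X a ω * X b ω) * (X c ω * X a ω) = X b ω * (X a ω * X a ω * X c ω) :=
            fun ω => by ring
          simp_rw [this, integral_mul_four_eq_zero hi hX (Ne.symm hab) (Ne.symm hab) hbc]
          simp [hab, hbc, hac]
      · have : ∀ ω, (X a ω * X b ω) * (X c ω * X d ω) = X a ω * (X b ω * X c ω * X d ω) :=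
          fun ω => by ring
        simp_rw [this, integral_mul_four_eq_zero hi hX hab hac had]
        simp [hab, hac, had]

lemma memLp_two_mul_gaussian_family (hX : ∀ i, HasLaw (X i) (gaussianReal 0 v) P) (a b : ι) :
    MemLp (fun ω => X a ω * X b ω) 2 P := by
  have : ENNReal.HolderTriple 4 4 2 := ⟨by
    rw [← two_mul, show (4 : ENNReal) = 2 * 2 by norm_num,
      ENNReal.mul_inv (by simp) (by simp), ← mul_assoc, ENNReal.mul_inv_cancel (by simp) (by simp),
      one_mul]⟩
  exact (memLp_of_hasLaw_gaussianReal (hX b) 4 (by simp)).mul'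
    (memLp_of_hasLaw_gaussianReal (hX a) 4 (by simp))

/-- The mean squared error of a quadratic form in independent centred Gaussians as an
estimator of a constant `s`. -/
theorem integral_sq_quadForm_sub (hi : iIndepFun X P)
    (hX : ∀ i, HasLaw (X i) (gaussianReal 0 v) P) (t : Finset ι) (M : ι → ι → ℝ) (s : ℝ) :
    Integrable (fun ω => (∑ a ∈ t, ∑ b ∈ t, M a b * (X a ω * X b ω) - s) ^ 2) P ∧
    ∫ ω, (∑ a ∈ t, ∑ b ∈ t, M a b * (X a ω * X b ω) - s) ^ 2 ∂P =
      (v * ∑ a ∈ t, M a a - s) ^ 2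
        + v ^ 2 / 2 * ∑ a ∈ t, ∑ b ∈ t, (M a b + M b a) ^ 2 := by
  classical
  have := hi.isProbabilityMeasure
  have hterm : ∀ a b, MemLp (fun ω => M a b * (X a ω * X b ω)) 2 P := fun a b =>
    (memLp_two_mul_gaussian_family hX a b).const_mul _
  have hQ : MemLp (fun ω => ∑ a ∈ t, ∑ b ∈ t, M a b * (X a ω * X b ω)) 2 P :=
    memLp_finsetSum _ fun a _ => memLp_finsetSum _ fun b _ => hterm a b
  have hQs := (hQ.sub (memLp_const s)).integrable_sq
  refine ⟨hQs, ?_⟩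
  have hmean : ∫ ω, ∑ a ∈ t, ∑ b ∈ t, M a b * (X a ω * X b ω) ∂P = v * ∑ a ∈ t, M a a := by
    rw [integral_finsetSum _ fun a _ => integrable_finsetSum _ fun b _ =>
      (hterm a b).integrable (by norm_num), Finset.mul_sum]
    refine Finset.sum_congr rfl fun a ha => ?_
    rw [integral_finsetSum _ fun b _ => (hterm a b).integrable (by norm_num)]
    simp_rw [integral_const_mul, integral_mul_gaussian_family hi hX]
    simp [ha, mul_comm]
  have hsq : ∫ ω, (∑ a ∈ t, ∑ b ∈ t, M a b * (X a ω * X b ω)) ^ 2 ∂P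
      = (v * ∑ a ∈ t, M a a) ^ 2 + v ^ 2 / 2 * ∑ a ∈ t, ∑ b ∈ t, (M a b + M b a) ^ 2 := by
    have hint : ∀ a b c d,
        Integrable (fun ω => M a b * M c d * ((X a ω * X b ω) * (X c ω * X d ω))) P :=
      fun a b c d => ((memLp_two_mul_gaussian_family hX a b).integrable_mul
        (memLp_two_mul_gaussian_family hX c d)).const_mul _
    have e : ∀ ω, (∑ a ∈ t, ∑ b ∈ t, M a b * (X a ω * X b ω)) ^ 2
        = ∑ a ∈ t, ∑ b ∈ t, ∑ c ∈ t, ∑ d ∈ t,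
          M a b * M c d * ((X a ω * X b ω) * (X c ω * X d ω)) := by
      intro ω
      rw [sq, Finset.sum_mul]
      refine Finset.sum_congr rfl fun a _ => ?_
      rw [Finset.sum_mul]
      refine Finset.sum_congr rfl fun b _ => ?_
      rw [Finset.mul_sum]
      refine Finset.sum_congr rfl fun c _ => ?_
      rw [Finset.mul_sum]
      refine Finset.sum_congr rfl fun d _ => ?_
      ring
    have e2 : ∫ ω, (∑ a ∈ t, ∑ b ∈ t, M a b * (X a ω * X b ω)) ^ 2 ∂P
        = ∑ a ∈ t, ∑ b ∈ t, ∑ c ∈ t, ∑ d ∈ t, M a b * M c d *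
          ((v : ℝ) ^ 2 * ((if a = b ∧ c = d then 1 else 0) + (if a = c ∧ b = d then 1 else 0)
        + (if a = d ∧ b = c then 1 else 0))) := by
      simp_rw [e]
      rw [integral_finsetSum _ fun a _ => integrable_finsetSum _ fun b _ =>
        integrable_finsetSum _ fun c _ => integrable_finsetSum _ fun d _ => hint a b c d]
      refine Finset.sum_congr rfl fun a _ => ?_
      rw [integral_finsetSum _ fun b _ =>
        integrable_finsetSum _ fun c _ => integrable_finsetSum _ fun d _ => hint a b c d]
      refine Finset.sum_congr rfl fun b _ => ?_
      rw [integral_finsetSum _ fun c _ => integrable_finsetSum _ fun d _ => hint a b c d]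
      refine Finset.sum_congr rfl fun c _ => ?_
      rw [integral_finsetSum _ fun d _ => hint a b c d]
      refine Finset.sum_congr rfl fun d _ => ?_
      rw [integral_const_mul, integral_mul_four_gaussian_family hi hX]
    -- The three pairings give the squared trace, `∑ M a b ^ 2` and `∑ M a b * M b a`; the last two
    -- make up half of the squared norm of the symmetrised matrix.
    have s1 : ∑ a ∈ t, ∑ b ∈ t, ∑ c ∈ t, ∑ d ∈ t,
        M a b * M c d * (if a = b ∧ c = d then 1 else 0) = (∑ a ∈ t, M a a) ^ 2 := by
      rw [sq, Finset.sum_mul_sum]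
      refine Finset.sum_congr rfl fun a ha => ?_
      simp_rw [ite_and, mul_ite, mul_one, mul_zero]
      rw [Finset.sum_eq_single a (fun b _ hb => by simp [Ne.symm hb]) (by simp [ha])]
      refine Finset.sum_congr rfl fun c hc => ?_
      simp [hc]
    have s2 : ∑ a ∈ t, ∑ b ∈ t, ∑ c ∈ t, ∑ d ∈ t,
        M a b * M c d * (if a = c ∧ b = d then 1 else 0)
          = ∑ a ∈ t, ∑ b ∈ t, M a b * M a b := by
      refine Finset.sum_congr rfl fun a ha => Finset.sum_congr rfl fun b hb => ?_
      rw [Finset.sum_eq_single a (fun c _ hc => by simp [Ne.symm hc]) (by simp [ha])]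
      simp [hb]
    have s3 : ∑ a ∈ t, ∑ b ∈ t, ∑ c ∈ t, ∑ d ∈ t,
        M a b * M c d * (if a = d ∧ b = c then 1 else 0)
          = ∑ a ∈ t, ∑ b ∈ t, M a b * M b a := by
      refine Finset.sum_congr rfl fun a ha => Finset.sum_congr rfl fun b hb => ?_
      rw [Finset.sum_eq_single b (fun c _ hc => by simp [Ne.symm hc]) (by simp [hb])]
      simp [ha]
    have s4 : ∑ a ∈ t, ∑ b ∈ t, (M a b + M b a) ^ 2
        = 2 * (∑ a ∈ t, ∑ b ∈ t, M a b * M a b) + 2 * ∑ a ∈ t, ∑ b ∈ t, M a b * M b a := by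
      have : ∑ a ∈ t, ∑ b ∈ t, M b a * M b a = ∑ a ∈ t, ∑ b ∈ t, M a b * M a b :=
        Finset.sum_comm
      rw [two_mul (∑ a ∈ t, ∑ b ∈ t, M a b * M a b)]
      nth_rewrite 2 [← this]
      simp_rw [Finset.mul_sum, ← Finset.sum_add_distrib]
      refine Finset.sum_congr rfl fun a _ => Finset.sum_congr rfl fun b _ => by ring
    rw [e2, mul_pow, s4, ← s1, ← s2, ← s3]
    simp_rw [mul_add, mul_left_comm _ ((v : ℝ) ^ 2), Finset.sum_add_distrib, ← Finset.mul_sum]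
    ring
  have e3 : ∀ ω, (∑ a ∈ t, ∑ b ∈ t, M a b * (X a ω * X b ω) - s) ^ 2
      = (∑ a ∈ t, ∑ b ∈ t, M a b * (X a ω * X b ω)) ^ 2
        - 2 * s * (∑ a ∈ t, ∑ b ∈ t, M a b * (X a ω * X b ω)) + s ^ 2 := fun ω => by ring
  have hQ1 := (hQ.integrable (by norm_num)).const_mul (2 * s)
  have hQ2 : Integrable (fun ω => (∑ a ∈ t, ∑ b ∈ t, M a b * (X a ω * X b ω)) ^ 2
      - 2 * s * ∑ a ∈ t, ∑ b ∈ t, M a b * (X a ω * X b ω)) P := hQ.integrable_sq.sub hQ1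
  simp_rw [e3]
  rw [integral_add hQ2 (integrable_const (s ^ 2)),
    integral_sub hQ.integrable_sq hQ1, integral_const_mul, hmean, hsq]
  simp
  ring

end GaussianFamily

/-! ### Slowly decaying step sizes -/

/-- Turns estimates valid only for large indices, typically once the steps are at most 1, into
bounds with a global constant. -/
lemma exists_bound_of_forall_ge {f : ℕ → ℝ} {K : ℝ} {m : ℕ} (h : ∀ i, m ≤ i → f i ≤ K) :
    ∃ K' : ℝ, 0 < K' ∧ ∀ i, f i ≤ K' := by
  refine ⟨|K| + ∑ j ∈ Finset.range m, |f j| + 1, by positivity, fun i => ?_⟩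
  have h0 : 0 ≤ ∑ j ∈ Finset.range m, |f j| := Finset.sum_nonneg fun _ _ => abs_nonneg _
  rcases le_or_gt m i with hi | hi
  · have := h i hi
    have := le_abs_self K
    linarith
  · have h1 := Finset.single_le_sum (f := fun j => |f j|) (fun _ _ => abs_nonneg _)
      (Finset.mem_range.2 hi)
    have h2 := le_abs_self (f i)
    have h3 := abs_nonneg K
    linarith

/-- Positive nonincreasing step sizes that tend to zero more slowly than `1 / i`. -/
structure IsSlowStep (s : ℕ → ℝ) : Prop where
  pos : ∀ i, 1 ≤ i → 0 < s i
  anti : ∀ i j, 1 ≤ i → i ≤ j → s j ≤ s i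
  tendsto : Filter.Tendsto s Filter.atTop (nhds 0)
  inv_sub : Filter.Tendsto (fun i => (s (i + 1))⁻¹ - (s i)⁻¹) Filter.atTop (nhds 0)

namespace IsSlowStep

variable {s : ℕ → ℝ}

lemma exists_forall_le (hs : IsSlowStep s) {ε : ℝ} (hε : 0 < ε) :
    ∃ m, 1 ≤ m ∧ ∀ i, m ≤ i → s i ≤ ε := by
  obtain ⟨m, hm⟩ := Filter.eventually_atTop.1 (hs.tendsto.eventually_le_const hε)
  exact ⟨m + 1, by omega, fun i hi => hm i (by omega)⟩

lemma exists_forall_inv_sub_le (hs : IsSlowStep s) {ε : ℝ} (hε : 0 < ε) :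
    ∃ m, 1 ≤ m ∧ ∀ i, m ≤ i → (s (i + 1))⁻¹ - (s i)⁻¹ ≤ ε := by
  obtain ⟨m, hm⟩ := Filter.eventually_atTop.1 (hs.inv_sub.eventually_le_const hε)
  exact ⟨m + 1, by omega, fun i hi => hm i (by omega)⟩

/-- Once the steps are at most 1, the right-hand side is a convex combination of `u i` and `D`, so
the maximum of the two is never exceeded. -/
lemma exists_bound_of_rec (hs : IsSlowStep s) {u : ℕ → ℝ} {D : ℝ} {m₀ : ℕ}
    (hu : ∀ i, m₀ ≤ i → u (i + 1) ≤ |1 - s (i + 1)| * u i + D * s (i + 1)) :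
    ∃ K, 0 < K ∧ ∀ i, u i ≤ K := by
  obtain ⟨m, hm, h⟩ := hs.exists_forall_le one_pos
  refine exists_bound_of_forall_ge (K := max (u (max m m₀)) D) (m := max m m₀) fun i hi => ?_
  induction i, hi using Nat.le_induction with
  | base => exact le_max_left _ _
  | succ i hi ih =>
    have h1 := h (i + 1) (by omega)
    have h2 := hs.pos (i + 1) (by omega)
    have h3 := le_max_right (u (max m m₀)) D
    have h4 := hu i (by omega)
    rw [abs_of_nonneg (by linarith)] at h4
    nlinarith

end IsSlowStep

/-! ### Response coefficients: uniform row and column sums -/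

/-- The coefficient of the `a + 1`-st observation in the `i`-th iterate of SGD for mean
estimation with step sizes `s`. -/
noncomputable def response (s : ℕ → ℝ) : ℕ → ℕ → ℝ
  | 0, _ => 0
  | i + 1, a => (1 - s (i + 1)) * response s i a + if a = i then s (i + 1) else 0

section response

variable {s : ℕ → ℝ}

lemma response_succ (i a : ℕ) : response s (i + 1) a
    = (1 - s (i + 1)) * response s i a + if a = i then s (i + 1) else 0 := rfl

lemma response_eq_zero {i a : ℕ} (h : i ≤ a) : response s i a = 0 := by
  induction i with
  | zero => rfl
  | succ i ih => rw [response_succ, ih (by omega), if_neg (by omega)]; simp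

lemma response_self (a : ℕ) : response s (a + 1) a = s (a + 1) := by
  rw [response_succ, response_eq_zero le_rfl]; simp

lemma response_succ_of_lt {i a : ℕ} (h : a < i) :
    response s (i + 1) a = (1 - s (i + 1)) * response s i a := by
  rw [response_succ, if_neg (by omega), add_zero]

lemma abs_response_add (a k : ℕ) : |response s (a + 1 + k) a|
    = |s (a + 1)| * ∏ j ∈ Finset.range k, |1 - s (a + 1 + j + 1)| := by
  induction k with
  | zero => simp [response_self]
  | succ k ih =>
    rw [← add_assoc, response_succ_of_lt (by omega), abs_mul, ih, Finset.prod_range_succ]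
    ring

/-- The influence of one observation lasts for about `1 / s m` steps. The sums satisfy `W m (d + 1)
= 1 + |1 - s (m + 1)| * W (m + 1) d`, which preserves the bound `2 / s m` when `1 / s` grows by at
most `1 / 2` per step. -/
lemma IsSlowStep.exists_sum_prod_le (hs : IsSlowStep s) : ∃ K, 0 < K ∧ ∀ m, 1 ≤ m → ∀ d,
    s m * ∑ k ∈ Finset.range d, ∏ j ∈ Finset.range k, |1 - s (m + j + 1)| ≤ K := by
  set W : ℕ → ℕ → ℝ := fun m d =>
    ∑ k ∈ Finset.range d, ∏ j ∈ Finset.range k, |1 - s (m + j + 1)| with hW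
  have hW0 : ∀ m, W m 0 = 0 := fun m => by simp [hW]
  have hWs : ∀ m d, W m (d + 1) = 1 + |1 - s (m + 1)| * W (m + 1) d := fun m d => by
    simp only [hW]
    rw [Finset.sum_range_succ', Finset.mul_sum, add_comm]
    congr 1
    refine Finset.sum_congr rfl fun k _ => ?_
    rw [Finset.prod_range_succ', mul_comm]
    congr 1
    refine Finset.prod_congr rfl fun j _ => ?_
    congr 3
    omega
  obtain ⟨m₁, hm₁, h1⟩ := hs.exists_forall_le one_pos
  obtain ⟨m₂, hm₂, h2⟩ := hs.exists_forall_inv_sub_le (ε := 1 / 2) (by norm_num)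
  set m₀ := max m₁ m₂
  have hlarge : ∀ d m, m₀ ≤ m → W m d ≤ 2 * (s m)⁻¹ := by
    intro d
    induction d with
    | zero =>
      intro m hm
      rw [hW0]
      have := hs.pos m (by omega)
      positivity
    | succ d ih =>
      intro m hm
      have hp := hs.pos (m + 1) (by omega)
      have hle := h1 (m + 1) (by omega)
      have hd := h2 m (by omega)
      rw [hWs, abs_of_nonneg (by linarith)]
      have h3 := mul_le_mul_of_nonneg_left (ih (m + 1) (by omega)) (sub_nonneg.2 hle)
      have h4 : (1 - s (m + 1)) * (2 * (s (m + 1))⁻¹) = 2 * (s (m + 1))⁻¹ - 2 := by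
        field_simp
      linarith
  -- Below `m₀` the recursion is unrolled until it reaches `m₀`. These bounds need not be uniform,
  -- as only finitely many `m` are concerned.
  have hany : ∀ j m, m₀ ≤ m + j → ∃ b, ∀ d, W m d ≤ b := by
    intro j
    induction j with
    | zero => exact fun m hm => ⟨_, fun d => hlarge d m (by omega)⟩
    | succ j ih =>
      intro m hm
      obtain ⟨b, hb⟩ := ih (m + 1) (by omega)
      refine ⟨1 + |1 - s (m + 1)| * |b|, fun d => ?_⟩
      cases d with
      | zero => rw [hW0]; positivity
      | succ d =>
        rw [hWs]
        gcongr
        exact (hb d).trans (le_abs_self b)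
  have hboth : ∀ m, ∃ b, (∀ d, W m d ≤ b) ∧ (m₀ ≤ m → b = 2 * (s m)⁻¹) := by
    intro m
    by_cases hm : m₀ ≤ m
    · exact ⟨_, fun d => hlarge d m hm, fun _ => rfl⟩
    · obtain ⟨b, hb⟩ := hany m₀ m (by omega)
      exact ⟨b, hb, fun h => absurd h hm⟩
  choose b hb hb' using hboth
  obtain ⟨K, hK, h⟩ := exists_bound_of_forall_ge (f := fun m => s m * b m) (K := 2) (m := m₀)
    fun m hm => by
      have := hs.pos m (by omega)
      rw [hb' m hm]
      field_simp
      rfl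
  exact ⟨K, hK, fun m hm d =>
    (mul_le_mul_of_nonneg_left (hb m d) (hs.pos m hm).le).trans (h m)⟩

/-- Row sums are dominated by the recursion `r`, which averages with 1; column sums are the
geometric-like sums of `exists_sum_prod_le`. -/
lemma IsSlowStep.exists_sum_abs_response_le (hs : IsSlowStep s) : ∃ K, 0 < K ∧
    (∀ k N, ∑ a ∈ Finset.range N, |response s k a| ≤ K) ∧
    ∀ a (t : Finset ℕ), ∑ k ∈ t, |response s k a| ≤ K := by
  obtain ⟨K₁, hK₁, h1⟩ := hs.exists_sum_prod_le
  set r : ℕ → ℝ := Nat.rec 0 fun i x => |1 - s (i + 1)| * x + |s (i + 1)| with hr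
  have hrs : ∀ i, r (i + 1) = |1 - s (i + 1)| * r i + |s (i + 1)| := fun i => rfl
  obtain ⟨K₂, hK₂, h2⟩ := hs.exists_bound_of_rec (u := r) (D := 1) (m₀ := 0) fun i _ => by
    rw [hrs, abs_of_pos (hs.pos (i + 1) (by omega)), one_mul]
  refine ⟨K₁ + K₂, by positivity, fun k N => ?_, fun a t => ?_⟩
  · have : ∑ a ∈ Finset.range N, |response s k a| ≤ r k := by
      induction k with
      | zero => simp [response, hr]
      | succ k ih =>
        rw [hrs]
        calc ∑ a ∈ Finset.range N, |response s (k + 1) a|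
            ≤ ∑ a ∈ Finset.range N, (|1 - s (k + 1)| * |response s k a|
              + if a = k then |s (k + 1)| else 0) := by
              refine Finset.sum_le_sum fun a _ => ?_
              rw [response_succ, ← abs_mul]
              refine (abs_add_le _ _).trans (le_of_eq ?_)
              split_ifs <;> simp
          _ ≤ _ := by
              rw [Finset.sum_add_distrib, ← Finset.mul_sum]
              gcongr
              rw [Finset.sum_ite_eq']
              split_ifs
              · exact le_rfl
              · positivity
    linarith [h2 k]
  · obtain ⟨N, hN⟩ := t.exists_nat_subset_range
    have hp := hs.pos (a + 1) (by omega)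
    calc ∑ k ∈ t, |response s k a|
        ≤ ∑ k ∈ Finset.range (a + 1 + N), |response s k a| :=
          Finset.sum_le_sum_of_subset_of_nonneg
            (hN.trans (Finset.range_subset_range.2 (by omega))) fun _ _ _ => abs_nonneg _
      _ = ∑ k ∈ Finset.range N, |response s (a + 1 + k) a| := by
          rw [Finset.sum_range_add, Finset.sum_eq_zero, zero_add]
          intro k hk
          rw [response_eq_zero (by rw [Finset.mem_range] at hk; omega), abs_zero]
      _ = s (a + 1) * ∑ k ∈ Finset.range N,
            ∏ j ∈ Finset.range k, |1 - s (a + 1 + j + 1)| := by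
          simp_rw [abs_response_add, abs_of_pos hp, Finset.mul_sum]
      _ ≤ K₁ := h1 _ (by omega) _
      _ ≤ K₁ + K₂ := by linarith

end response

/-! ### The estimator as a quadratic form, and its norm from above -/

/-- The sum of the coefficients of the `b + 1`-st observation over the batch ending at `i`. -/
noncomputable def batchResponse (s : ℕ → ℝ) (ℓ : ℕ → ℕ) (i b : ℕ) : ℝ :=
  ∑ k ∈ Finset.Ioc (i - ℓ i) i, response s k b

/-- `n` times the coefficients of the quadratic form computed by the oracle estimator. -/
noncomputable def oracleForm (s : ℕ → ℝ) (ℓ : ℕ → ℕ) (n a b : ℕ) : ℝ :=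
  ∑ i ∈ Finset.Icc 1 n,
    (2 * response s i a * batchResponse s ℓ i b - response s i a * response s i b)

/-- The step sizes `η i ^ (-α)`. -/
noncomputable def stepSize (η α : ℝ) (i : ℕ) : ℝ := η * (i : ℝ) ^ (-α)

lemma sgdIterate_eq_sum (η α : ℝ) (ξ : ℕ → ℝ) {i N : ℕ} (h : i ≤ N) :
    sgdIterate η α ξ i
      = ∑ a ∈ Finset.range N, response (stepSize η α) i a * ξ (a + 1) := by
  induction i with
  | zero => simp [sgdIterate, response]
  | succ i ih =>
    have e : ∑ a ∈ Finset.range N, (if a = i then stepSize η α (i + 1) else 0) * ξ (a + 1)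
        = stepSize η α (i + 1) * ξ (i + 1) := by
      simp only [ite_mul, zero_mul]
      rw [Finset.sum_ite_eq', if_pos (by simp; omega)]
    simp_rw [response_succ, add_mul, Finset.sum_add_distrib, e, mul_assoc, ← Finset.mul_sum,
      ← ih (by omega)]
    rw [sgdIterate, stepSize]
    ring

lemma oracleEstimator_sgdIterate (η α : ℝ) (ξ : ℕ → ℝ) (ℓ : ℕ → ℕ) (n : ℕ) :
    oracleEstimator (sgdIterate η α ξ) ℓ n
      = ∑ a ∈ Finset.range n, ∑ b ∈ Finset.range n,
        (1 / n * oracleForm (stepSize η α) ℓ n a b) * (ξ (a + 1) * ξ (b + 1)) := by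
  set s := stepSize η α
  have h : ∀ i ∈ Finset.Icc 1 n, 2 * sgdIterate η α ξ i
        * (∑ k ∈ Finset.Ioc (i - ℓ i) i, sgdIterate η α ξ k) - sgdIterate η α ξ i ^ 2
      = ∑ a ∈ Finset.range n, ∑ b ∈ Finset.range n,
        (2 * response s i a * batchResponse s ℓ i b - response s i a * response s i b)
          * (ξ (a + 1) * ξ (b + 1)) := by
    intro i hi
    have hi' := (Finset.mem_Icc.1 hi).2
    have hB : ∑ k ∈ Finset.Ioc (i - ℓ i) i, sgdIterate η α ξ k
        = ∑ b ∈ Finset.range n, batchResponse s ℓ i b * ξ (b + 1) := by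
      rw [Finset.sum_congr rfl fun k hk => sgdIterate_eq_sum η α ξ
        ((Finset.mem_Ioc.1 hk).2.trans hi'), Finset.sum_comm]
      simp_rw [batchResponse, Finset.sum_mul]
      rfl
    rw [hB, sgdIterate_eq_sum η α ξ hi', sq, mul_assoc, Finset.sum_mul_sum, Finset.sum_mul_sum,
      Finset.mul_sum, ← Finset.sum_sub_distrib]
    refine Finset.sum_congr rfl fun a _ => ?_
    rw [Finset.mul_sum, ← Finset.sum_sub_distrib]
    refine Finset.sum_congr rfl fun b _ => ?_
    ring
  rw [oracleEstimator, Finset.sum_congr rfl h, Finset.sum_comm, Finset.mul_sum]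
  refine Finset.sum_congr rfl fun a _ => ?_
  rw [Finset.sum_comm, Finset.mul_sum]
  refine Finset.sum_congr rfl fun b _ => ?_
  rw [← Finset.sum_mul, oracleForm]
  ring

/-- A sum of squares is at most the largest entry times the absolute sum. Column sums bound every
entry by `3 * K ^ 2`; row sums bound the absolute sum, a batch contributing at most `K * ℓ i`. -/
lemma sum_sq_oracleForm_le {s : ℕ → ℝ} {K : ℝ} (ℓ : ℕ → ℕ) (hK : 0 < K)
    (hrow : ∀ k N, ∑ a ∈ Finset.range N, |response s k a| ≤ K)
    (hcol : ∀ a (t : Finset ℕ), ∑ k ∈ t, |response s k a| ≤ K) (n : ℕ) :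
    ∑ a ∈ Finset.range n, ∑ b ∈ Finset.range n,
        (oracleForm s ℓ n a b + oracleForm s ℓ n b a) ^ 2
      ≤ 12 * K ^ 4 * ∑ i ∈ Finset.Icc 1 n, (2 * (ℓ i : ℝ) + 1) := by
  have hentry : ∀ k a, |response s k a| ≤ K := fun k a => by simpa using hcol a {k}
  have hB : ∀ i b, |batchResponse s ℓ i b| ≤ K := fun i b =>
    (Finset.abs_sum_le_sum_abs _ _).trans (hcol b _)
  have hBrow : ∀ i, ∑ b ∈ Finset.range n, |batchResponse s ℓ i b| ≤ K * ℓ i := by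
    intro i
    calc ∑ b ∈ Finset.range n, |batchResponse s ℓ i b|
        ≤ ∑ b ∈ Finset.range n, ∑ k ∈ Finset.Ioc (i - ℓ i) i, |response s k b| :=
          Finset.sum_le_sum fun b _ => Finset.abs_sum_le_sum_abs _ _
      _ = ∑ k ∈ Finset.Ioc (i - ℓ i) i, ∑ b ∈ Finset.range n, |response s k b| :=
          Finset.sum_comm
      _ ≤ ∑ k ∈ Finset.Ioc (i - ℓ i) i, K := Finset.sum_le_sum fun k _ => hrow k n
      _ = (i - (i - ℓ i) : ℕ) * K := by simp
      _ ≤ K * ℓ i := by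
          rw [mul_comm]
          gcongr
          omega
  have habs : ∀ a b, |oracleForm s ℓ n a b| ≤ ∑ i ∈ Finset.Icc 1 n,
      (2 * |response s i a| * |batchResponse s ℓ i b| + |response s i a| * |response s i b|) := by
    intro a b
    refine (Finset.abs_sum_le_sum_abs _ _).trans (Finset.sum_le_sum fun i _ => ?_)
    refine (abs_sub _ _).trans (le_of_eq ?_)
    simp [abs_mul]
  have hmax : ∀ a b, |oracleForm s ℓ n a b| ≤ 3 * K ^ 2 := by
    intro a b
    refine (habs a b).trans ?_
    calc _ ≤ ∑ i ∈ Finset.Icc 1 n, |response s i a| * (3 * K) := by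
          refine Finset.sum_le_sum fun i _ => ?_
          have := mul_le_mul_of_nonneg_left (hB i b) (abs_nonneg (response s i a))
          have := mul_le_mul_of_nonneg_left (hentry i b) (abs_nonneg (response s i a))
          linarith
      _ ≤ K * (3 * K) := by
          rw [← Finset.sum_mul]
          gcongr
          exact hcol a _
      _ = 3 * K ^ 2 := by ring
  have hsum : ∑ a ∈ Finset.range n, ∑ b ∈ Finset.range n, |oracleForm s ℓ n a b|
      ≤ K ^ 2 * ∑ i ∈ Finset.Icc 1 n, (2 * (ℓ i : ℝ) + 1) := by
    calc ∑ a ∈ Finset.range n, ∑ b ∈ Finset.range n, |oracleForm s ℓ n a b|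
        ≤ ∑ a ∈ Finset.range n, ∑ b ∈ Finset.range n, ∑ i ∈ Finset.Icc 1 n,
          (2 * |response s i a| * |batchResponse s ℓ i b|
            + |response s i a| * |response s i b|) :=
          Finset.sum_le_sum fun a _ => Finset.sum_le_sum fun b _ => habs a b
      _ = ∑ i ∈ Finset.Icc 1 n, (∑ a ∈ Finset.range n, |response s i a|)
          * (2 * ∑ b ∈ Finset.range n, |batchResponse s ℓ i b|
            + ∑ b ∈ Finset.range n, |response s i b|) := by
          simp_rw [Finset.sum_comm (s := Finset.range n) (t := Finset.Icc 1 n)]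
          refine Finset.sum_congr rfl fun i _ => ?_
          rw [Finset.mul_sum, ← Finset.sum_add_distrib, Finset.sum_mul_sum]
          refine Finset.sum_congr rfl fun a _ => Finset.sum_congr rfl fun b _ => ?_
          ring
      _ ≤ ∑ i ∈ Finset.Icc 1 n, K * (2 * (K * ℓ i) + K) := by
          refine Finset.sum_le_sum fun i _ => ?_
          have h1 := hBrow i
          have h2 := hrow i n
          have h3 : 0 ≤ ∑ b ∈ Finset.range n, |batchResponse s ℓ i b| :=
            Finset.sum_nonneg fun _ _ => abs_nonneg _
          have h4 : 0 ≤ ∑ b ∈ Finset.range n, |response s i b| :=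
            Finset.sum_nonneg fun _ _ => abs_nonneg _
          gcongr
      _ = _ := by
          rw [Finset.mul_sum]
          refine Finset.sum_congr rfl fun i _ => ?_
          ring
  have hsq : ∑ a ∈ Finset.range n, ∑ b ∈ Finset.range n, oracleForm s ℓ n a b ^ 2
      ≤ 3 * K ^ 2 * (K ^ 2 * ∑ i ∈ Finset.Icc 1 n, (2 * (ℓ i : ℝ) + 1)) := by
    refine le_trans ?_ (mul_le_mul_of_nonneg_left hsum (by positivity))
    simp_rw [Finset.mul_sum]
    refine Finset.sum_le_sum fun a _ => Finset.sum_le_sum fun b _ => ?_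
    rw [← sq_abs, sq]
    exact mul_le_mul_of_nonneg_right (hmax a b) (abs_nonneg _)
  calc _ ≤ ∑ a ∈ Finset.range n, ∑ b ∈ Finset.range n,
        (2 * oracleForm s ℓ n a b ^ 2 + 2 * oracleForm s ℓ n b a ^ 2) :=
        Finset.sum_le_sum fun a _ => Finset.sum_le_sum fun b _ => by
          nlinarith [sq_nonneg (oracleForm s ℓ n a b - oracleForm s ℓ n b a)]
    _ = 4 * ∑ a ∈ Finset.range n, ∑ b ∈ Finset.range n, oracleForm s ℓ n a b ^ 2 := by
        simp_rw [Finset.sum_add_distrib, ← Finset.mul_sum]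
        rw [Finset.sum_comm (f := fun a b => oracleForm s ℓ n b a ^ 2)]
        ring
    _ ≤ _ := by linarith

/-! ### The trace of the form, that is, the bias -/

/-- The variance of the `i`-th iterate, in units of the variance of the observations. -/
noncomputable def iterVar (s : ℕ → ℝ) : ℕ → ℝ
  | 0 => 0
  | i + 1 => (1 - s (i + 1)) ^ 2 * iterVar s i + s (i + 1) ^ 2

/-- The sum of the covariances of the `i`-th iterate with the iterates up to the `i`-th, in units
of the variance of the observations. -/
noncomputable def iterCovSum (s : ℕ → ℝ) : ℕ → ℝ
  | 0 => 0
  | i + 1 => (1 - s (i + 1)) * iterCovSum s i + iterVar s (i + 1)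

section trace

variable {s : ℕ → ℝ}

lemma iterVar_succ (i : ℕ) :
    iterVar s (i + 1) = (1 - s (i + 1)) ^ 2 * iterVar s i + s (i + 1) ^ 2 := rfl

lemma iterCovSum_succ (i : ℕ) :
    iterCovSum s (i + 1) = (1 - s (i + 1)) * iterCovSum s i + iterVar s (i + 1) := rfl

lemma iterVar_nonneg (i : ℕ) : 0 ≤ iterVar s i := by
  induction i with
  | zero => exact le_rfl
  | succ i ih => rw [iterVar_succ]; positivity

lemma sum_response_sq {k n : ℕ} (h : k ≤ n) :
    ∑ a ∈ Finset.range n, response s k a * response s k a = iterVar s k := by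
  induction k with
  | zero => simp [response, iterVar]
  | succ k ih =>
    have e : ∀ a, response s (k + 1) a * response s (k + 1) a
        = (1 - s (k + 1)) ^ 2 * (response s k a * response s k a)
          + if a = k then s (k + 1) ^ 2 else 0 := by
      intro a
      rw [response_succ]
      split_ifs with ha
      · rw [ha, response_eq_zero le_rfl]
        ring
      · ring
    simp_rw [e]
    rw [Finset.sum_add_distrib, ← Finset.mul_sum, ih (by omega), Finset.sum_ite_eq',
      if_pos (by simp; omega), iterVar_succ]

/-- Observations after time `k` are orthogonal to the `k`-th iterate, so each further step only
contracts the covariance. -/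
lemma sum_response_mul_response {k i n : ℕ} (hk : k ≤ i) (hi : i ≤ n) :
    ∑ a ∈ Finset.range n, response s i a * response s k a
      = iterVar s k * ∏ j ∈ Finset.Ioc k i, (1 - s j) := by
  induction i, hk using Nat.le_induction with
  | base => simp [sum_response_sq hi]
  | succ i hk ih =>
    have e : ∀ a, response s (i + 1) a * response s k a
        = (1 - s (i + 1)) * (response s i a * response s k a) := by
      intro a
      rw [response_succ]
      split_ifs with ha
      · rw [ha, response_eq_zero hk]
        ring
      · ring
    simp_rw [e]
    rw [← Finset.mul_sum, ih (by omega), ← Finset.insert_Ioc_right_eq_Ioc_add_one (by omega),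
      Finset.prod_insert (by simp)]
    ring

/-- Unrolling `iterCovSum` from `i` down to `m`: all covariances cut off share the factor of the
steps after `m`. -/
lemma sum_Ioc_iterVar_mul_prod {m i : ℕ} (h : m ≤ i) :
    ∑ k ∈ Finset.Ioc m i, iterVar s k * ∏ j ∈ Finset.Ioc k i, (1 - s j)
      = iterCovSum s i - (∏ j ∈ Finset.Ioc m i, (1 - s j)) * iterCovSum s m := by
  induction i, h using Nat.le_induction with
  | base => simp
  | succ i h ih =>
    have e : ∀ k ≤ i, ∏ j ∈ Finset.Ioc k (i + 1), (1 - s j)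
        = (1 - s (i + 1)) * ∏ j ∈ Finset.Ioc k i, (1 - s j) := fun k hk => by
      rw [← Finset.insert_Ioc_right_eq_Ioc_add_one hk, Finset.prod_insert (by simp)]
    rw [e m h, ← Finset.insert_Ioc_right_eq_Ioc_add_one h, Finset.sum_insert (by simp),
      Finset.sum_congr rfl fun k hk => by rw [e k (Finset.mem_Ioc.1 hk).2, mul_left_comm],
      ← Finset.mul_sum, ih, iterCovSum_succ, Finset.Ioc_self, Finset.prod_empty]
    ring

lemma sum_oracleForm_diag (ℓ : ℕ → ℕ) (n : ℕ) :
    ∑ a ∈ Finset.range n, oracleForm s ℓ n a a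
      = ∑ i ∈ Finset.Icc 1 n, (2 * iterCovSum s i - iterVar s i
        - 2 * (∏ j ∈ Finset.Ioc (i - ℓ i) i, (1 - s j)) * iterCovSum s (i - ℓ i)) := by
  simp_rw [oracleForm]
  rw [Finset.sum_comm]
  refine Finset.sum_congr rfl fun i hi => ?_
  have hi' := (Finset.mem_Icc.1 hi).2
  have hB : ∑ a ∈ Finset.range n, response s i a * batchResponse s ℓ i a
      = iterCovSum s i
        - (∏ j ∈ Finset.Ioc (i - ℓ i) i, (1 - s j)) * iterCovSum s (i - ℓ i) := by
    simp_rw [batchResponse, Finset.mul_sum]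
    rw [Finset.sum_comm, ← sum_Ioc_iterVar_mul_prod (Nat.sub_le _ _)]
    exact Finset.sum_congr rfl fun k hk =>
      sum_response_mul_response (Finset.mem_Ioc.1 hk).2 hi'
  rw [Finset.sum_sub_distrib, sum_response_sq hi']
  simp_rw [mul_assoc]
  rw [← Finset.mul_sum, hB]
  ring

/-- Allows index shifts in bounds: eventually `s i / s (i + 1) ≤ 1 + s i / 2 ≤ 3 / 2`. -/
lemma IsSlowStep.exists_le_mul_succ (hs : IsSlowStep s) :
    ∃ ρ, 0 < ρ ∧ ∀ i, 1 ≤ i → s i ≤ ρ * s (i + 1) := by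
  obtain ⟨m₁, hm₁, h1⟩ := hs.exists_forall_le one_pos
  obtain ⟨m₂, hm₂, h2⟩ := hs.exists_forall_inv_sub_le (ε := 1 / 2) (by norm_num)
  obtain ⟨K, hK, h⟩ := exists_bound_of_forall_ge (f := fun i => s i * (s (i + 1))⁻¹) (K := 3 / 2)
    (m := max m₁ m₂) fun i hi => by
      have hp := hs.pos i (by omega)
      have hd := h2 i (by omega)
      have hle := h1 i (by omega)
      have : s i * (s (i + 1))⁻¹ ≤ s i * ((s i)⁻¹ + 1 / 2) := by gcongr; linarith
      rw [mul_add, mul_inv_cancel₀ hp.ne'] at this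
      linarith
  refine ⟨K, hK, fun i hi => ?_⟩
  have hp := hs.pos (i + 1) (by omega)
  have := h i
  rwa [← div_eq_mul_inv, div_le_iff₀ hp] at this

/-- Contraction balances the noise `s ^ 2` at level `s`. With `x = s (i + 1)`, one factor `1 - x`
gains `L * x ^ 2`, while the change of step costs `3 / 4 * L * x ^ 2` and the noise `x ^ 2`, whence
`L ≥ 4`. Index 0 is excepted because `s 0` has no prescribed sign. -/
lemma IsSlowStep.exists_iterVar_le (hs : IsSlowStep s) :
    ∃ K, 0 < K ∧ ∀ i, iterVar s i ≤ K * s i ∨ i = 0 := by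
  obtain ⟨m₁, hm₁, h1⟩ := hs.exists_forall_le one_pos
  obtain ⟨m₂, hm₂, h2⟩ := hs.exists_forall_inv_sub_le (ε := 1 / 2) (by norm_num)
  obtain ⟨K, hK, h⟩ := exists_bound_of_forall_ge (f := fun i => iterVar s i * (s i)⁻¹)
    (K := max 4 (iterVar s (max m₁ m₂) * (s (max m₁ m₂))⁻¹)) (m := max m₁ m₂) fun i hi => by
      induction i, hi using Nat.le_induction with
      | base => exact le_max_right _ _
      | succ i hi ih =>
        set L := max 4 (iterVar s (max m₁ m₂) * (s (max m₁ m₂))⁻¹)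
        have hL : 4 ≤ L := le_max_left _ _
        have hp := hs.pos i (by omega)
        have hp' := hs.pos (i + 1) (by omega)
        have hd := h2 i (by omega)
        have hle := h1 i (by omega)
        have hle' := h1 (i + 1) (by omega)
        have ha := hs.anti i (i + 1) (by omega) (by omega)
        rw [← div_eq_mul_inv, div_le_iff₀ hp] at ih
        rw [← div_eq_mul_inv, div_le_iff₀ hp', iterVar_succ]
        have h3 : s i - s (i + 1) ≤ s (i + 1) * s i / 2 := by
          have := mul_le_mul_of_nonneg_left hd (mul_pos hp' hp).le
          have e : s (i + 1) * s i * ((s (i + 1))⁻¹ - (s i)⁻¹) = s i - s (i + 1) := by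
            field_simp
          linarith
        have h4 : s i ≤ s (i + 1) + 3 / 4 * s (i + 1) ^ 2 := by nlinarith
        generalize s (i + 1) = x at *
        have h5 : (1 - x) ^ 2 * iterVar s i ≤ (1 - x) * (L * (x + 3 / 4 * x ^ 2)) := by
          calc (1 - x) ^ 2 * iterVar s i ≤ (1 - x) * iterVar s i := by
                refine mul_le_mul_of_nonneg_right ?_ (iterVar_nonneg i)
                nlinarith
            _ ≤ _ := by
                refine mul_le_mul_of_nonneg_left ?_ (by linarith)
                exact ih.trans (mul_le_mul_of_nonneg_left h4 (by linarith))
        have h6 : 0 ≤ (L - 4) * x ^ 2 := mul_nonneg (by linarith) (sq_nonneg _)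
        have h7 : 0 ≤ L * x ^ 3 := by positivity
        nlinarith
  refine ⟨K, hK, fun i => ?_⟩
  rcases Nat.eq_zero_or_pos i with hi | hi
  · exact Or.inr hi
  · left
    have := h i
    rwa [← div_eq_mul_inv, div_le_iff₀ (hs.pos i hi)] at this

lemma IsSlowStep.exists_abs_iterCovSum_le (hs : IsSlowStep s) :
    ∃ K, 0 < K ∧ ∀ i, |iterCovSum s i| ≤ K := by
  obtain ⟨K, hK, h⟩ := hs.exists_iterVar_le
  refine hs.exists_bound_of_rec (D := K) (m₀ := 0) fun i _ => ?_
  rw [iterCovSum_succ, ← abs_mul]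
  refine (abs_add_le _ _).trans ?_
  rw [abs_of_nonneg (iterVar_nonneg _)]
  have := (h (i + 1)).resolve_right (by omega)
  linarith

lemma sum_range_sub_mul (u w : ℕ → ℝ) (N : ℕ) :
    ∑ i ∈ Finset.range N, (u (i + 1) - u i) * w i
      = u N * w N - u 0 * w 0 + ∑ i ∈ Finset.range N, u (i + 1) * (w i - w (i + 1)) := by
  induction N with
  | zero => simp
  | succ N ih => rw [Finset.sum_range_succ, ih, Finset.sum_range_succ]; ring

/-- Summation by parts with a comparison sequence `r`, applied with inverse steps as `r` and with
weights `r` and `r ^ 2`. -/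
lemma abs_sum_range_sub_mul_le {u w r : ℕ → ℝ} {K : ℝ} (h0 : u 0 = 0) (hr : 0 ≤ r 0)
    (hK : 0 ≤ K)
    (hN : ∀ N, |u N * w N| ≤ K * r N)
    (hw : ∀ i, |u (i + 1) * (w i - w (i + 1))| ≤ K * (r (i + 1) - r i)) (N : ℕ) :
    |∑ i ∈ Finset.range N, (u (i + 1) - u i) * w i| ≤ 2 * K * r N := by
  rw [sum_range_sub_mul, h0, zero_mul, sub_zero]
  have h1 : |∑ i ∈ Finset.range N, u (i + 1) * (w i - w (i + 1))| ≤ K * (r N - r 0) := by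
    rw [← Finset.sum_range_sub r N, Finset.mul_sum]
    exact (Finset.abs_sum_le_sum_abs _ _).trans (Finset.sum_le_sum fun i _ => hw i)
  have := abs_add_le (u N * w N) (∑ i ∈ Finset.range N, u (i + 1) * (w i - w (i + 1)))
  have := hN N
  nlinarith [mul_nonneg hK hr]

/-- The reason for the small bias: every deviation from 1 consists of increments over step sizes,
ready for summation by parts. -/
lemma two_mul_iterCovSum_sub_iterVar {i : ℕ} (h : s (i + 1) ≠ 0) :
    2 * iterCovSum s i - iterVar s i - 1
      = 2 * ((iterVar s (i + 1) - iterVar s i) * (s (i + 1))⁻¹)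
        - (iterVar s (i + 1) - iterVar s i) * (s (i + 1))⁻¹ ^ 2
        - 2 * ((iterCovSum s (i + 1) - iterCovSum s i) * (s (i + 1))⁻¹) := by
  rw [iterCovSum_succ, iterVar_succ]
  field_simp
  ring

/-- The bias of the oracle form: a boundary term and the covariances cut off by the batches. -/
lemma IsSlowStep.exists_abs_sum_oracleForm_diag_sub_le (hs : IsSlowStep s) : ∃ K, 0 < K ∧
    ∀ (ℓ : ℕ → ℕ) (n : ℕ), 1 ≤ n → |∑ a ∈ Finset.range n, oracleForm s ℓ n a a - n|
      ≤ K * ((s n)⁻¹ + ∑ i ∈ Finset.Icc 1 n, |∏ j ∈ Finset.Ioc (i - ℓ i) i, (1 - s j)|) := by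
  obtain ⟨ρ, hρ, hratio⟩ := hs.exists_le_mul_succ
  obtain ⟨V, hV, hVle⟩ := hs.exists_iterVar_le
  obtain ⟨G, hG, hGle⟩ := hs.exists_abs_iterCovSum_le
  set r : ℕ → ℝ := fun i => (s (i + 1))⁻¹ with hr
  have hspos : ∀ i, 0 < s (i + 1) := fun i => hs.pos (i + 1) (by omega)
  have hrpos : ∀ i, 0 < r i := fun i => inv_pos.2 (hspos i)
  have hrmono : ∀ i, r i ≤ r (i + 1) := fun i =>
    inv_anti₀ (hspos _) (hs.anti _ _ (by omega) (by omega))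
  have hrs : ∀ i, s (i + 1) * r i = 1 := fun i => mul_inv_cancel₀ (hspos i).ne'
  have hrρ : ∀ i, s (i + 1) * r (i + 1) ≤ ρ := fun i => by
    rw [hr, ← div_eq_mul_inv, div_le_iff₀ (hspos _)]
    exact hratio _ (by omega)
  have hv : ∀ i, iterVar s (i + 1) ≤ V * s (i + 1) := fun i =>
    (hVle (i + 1)).resolve_right (by omega)
  have hg1 : ∀ N, |∑ i ∈ Finset.range N, (iterCovSum s (i + 1) - iterCovSum s i) * r i|
      ≤ 2 * G * r N := by
    refine abs_sum_range_sub_mul_le rfl (hrpos 0).le hG.le (fun N => ?_) fun i => ?_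
    · rw [abs_mul, abs_of_pos (hrpos N)]
      exact mul_le_mul_of_nonneg_right (hGle N) (hrpos N).le
    · rw [abs_mul, abs_sub_comm (r i), abs_of_nonneg (sub_nonneg.2 (hrmono i))]
      exact mul_le_mul_of_nonneg_right (hGle _) (sub_nonneg.2 (hrmono i))
  have hvb : ∀ i, |iterVar s i| ≤ V * s 1 := fun i => by
    rw [abs_of_nonneg (iterVar_nonneg i)]
    cases i with
    | zero => exact mul_nonneg hV.le (hspos 0).le
    | succ i =>
      exact (hv i).trans (mul_le_mul_of_nonneg_left (hs.anti _ _ le_rfl (by omega)) hV.le)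
  have hv1 : ∀ N, |∑ i ∈ Finset.range N, (iterVar s (i + 1) - iterVar s i) * r i|
      ≤ 2 * (V * s 1) * r N := by
    refine abs_sum_range_sub_mul_le rfl (hrpos 0).le (mul_nonneg hV.le (hspos 0).le)
      (fun N => ?_) fun i => ?_
    · rw [abs_mul, abs_of_pos (hrpos N)]
      exact mul_le_mul_of_nonneg_right (hvb N) (hrpos N).le
    · rw [abs_mul, abs_sub_comm (r i), abs_of_nonneg (sub_nonneg.2 (hrmono i))]
      exact mul_le_mul_of_nonneg_right (hvb _) (sub_nonneg.2 (hrmono i))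
  -- The weight is `r ^ 2`, but `iterVar` is of the order of the step, so the boundary term is still
  -- of order `r N`.
  have hv2 : ∀ N, |∑ i ∈ Finset.range N, (iterVar s (i + 1) - iterVar s i) * r i ^ 2|
      ≤ 2 * (V * (1 + ρ)) * r N := by
    refine abs_sum_range_sub_mul_le (w := fun i => r i ^ 2) rfl (hrpos 0).le (by positivity)
      (fun N => ?_) fun i => ?_
    · rw [abs_of_nonneg (mul_nonneg (iterVar_nonneg N) (sq_nonneg _)), sq, ← mul_assoc]
      refine mul_le_mul_of_nonneg_right ?_ (hrpos N).le
      cases N with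
      | zero =>
        rw [iterVar, zero_mul]
        positivity
      | succ N =>
        have h1 := mul_le_mul_of_nonneg_right (hv N) (hrpos (N + 1)).le
        have h2 := mul_le_mul_of_nonneg_left (hrρ N) hV.le
        nlinarith
    · have e : r i ^ 2 - r (i + 1) ^ 2 = -((r i + r (i + 1)) * (r (i + 1) - r i)) := by ring
      have h1 : 0 ≤ (r i + r (i + 1)) * (r (i + 1) - r i) :=
        mul_nonneg (add_pos (hrpos _) (hrpos _)).le (sub_nonneg.2 (hrmono i))
      rw [e, mul_neg, abs_neg, abs_of_nonneg (mul_nonneg (iterVar_nonneg _) h1), ← mul_assoc]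
      refine mul_le_mul_of_nonneg_right ?_ (sub_nonneg.2 (hrmono i))
      calc iterVar s (i + 1) * (r i + r (i + 1))
          ≤ V * s (i + 1) * (r i + r (i + 1)) :=
            mul_le_mul_of_nonneg_right (hv i) (add_pos (hrpos _) (hrpos _)).le
        _ = V * (s (i + 1) * r i + s (i + 1) * r (i + 1)) := by ring
        _ ≤ V * (1 + ρ) := by
            rw [hrs]
            exact mul_le_mul_of_nonneg_left (by linarith [hrρ i]) hV.le
  set D := 4 * (V * s 1) + 2 * (V * (1 + ρ)) + 4 * G with hD
  have hDpos : 0 < D := by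
    have := mul_pos hV (hspos 0)
    rw [zero_add] at this
    positivity
  have hmain : ∀ N, |∑ i ∈ Finset.range N, (2 * iterCovSum s i - iterVar s i - 1)| ≤ D * r N := by
    intro N
    have e : ∑ i ∈ Finset.range N, (2 * iterCovSum s i - iterVar s i - 1)
        = 2 * ∑ i ∈ Finset.range N, (iterVar s (i + 1) - iterVar s i) * r i
          - ∑ i ∈ Finset.range N, (iterVar s (i + 1) - iterVar s i) * r i ^ 2
          - 2 * ∑ i ∈ Finset.range N, (iterCovSum s (i + 1) - iterCovSum s i) * r i := by
      rw [Finset.mul_sum, Finset.mul_sum, ← Finset.sum_sub_distrib, ← Finset.sum_sub_distrib]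
      exact Finset.sum_congr rfl fun i _ => two_mul_iterCovSum_sub_iterVar (hspos i).ne'
    have h1 := abs_le.1 (hv1 N)
    have h2 := abs_le.1 (hv2 N)
    have h3 := abs_le.1 (hg1 N)
    rw [e, abs_le, hD]
    constructor <;> linarith
  refine ⟨D * ρ ^ 2 + s 1 + 2 * G, by have := hspos 0; rw [zero_add] at this; positivity,
    fun ℓ n hn => ?_⟩
  -- The `+ 1` cancels the term `i = 0`, which equals `-1`.
  have hsplit : ∑ a ∈ Finset.range n, oracleForm s ℓ n a a - n
      = ∑ i ∈ Finset.range (n + 1), (2 * iterCovSum s i - iterVar s i - 1) + 1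
        - 2 * ∑ i ∈ Finset.Icc 1 n,
          (∏ j ∈ Finset.Ioc (i - ℓ i) i, (1 - s j)) * iterCovSum s (i - ℓ i) := by
    have e : ∑ i ∈ Finset.range (n + 1), (2 * iterCovSum s i - iterVar s i - 1) + 1
        = ∑ i ∈ Finset.Icc 1 n, (2 * iterCovSum s i - iterVar s i) - n := by
      rw [Finset.range_eq_Ico, Finset.sum_eq_sum_Ico_succ_bot (by omega)]
      have : Finset.Ico (0 + 1) (n + 1) = Finset.Icc 1 n := by ext; simp
      rw [this, Finset.sum_sub_distrib _ (fun _ => (1 : ℝ))]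
      simp [iterCovSum, iterVar]
    rw [e, sum_oracleForm_diag, Finset.sum_sub_distrib, Finset.mul_sum]
    simp_rw [mul_assoc]
    ring
  have htail : |∑ i ∈ Finset.Icc 1 n,
      (∏ j ∈ Finset.Ioc (i - ℓ i) i, (1 - s j)) * iterCovSum s (i - ℓ i)|
      ≤ G * ∑ i ∈ Finset.Icc 1 n, |∏ j ∈ Finset.Ioc (i - ℓ i) i, (1 - s j)| := by
    rw [Finset.mul_sum]
    refine (Finset.abs_sum_le_sum_abs _ _).trans (Finset.sum_le_sum fun i _ => ?_)
    rw [abs_mul, mul_comm]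
    exact mul_le_mul_of_nonneg_right (hGle _) (abs_nonneg _)
  have hsn := hs.pos n hn
  -- The sum runs over `range (n + 1)`, so its boundary term is the inverse of `s (n + 2)`: two
  -- index shifts, hence `ρ ^ 2`.
  have hr2 : r (n + 1) ≤ ρ ^ 2 * (s n)⁻¹ := by
    have h1 := hratio n hn
    have h2 := hratio (n + 1) (by omega)
    have h3 : s n ≤ ρ ^ 2 * s (n + 1 + 1) := by nlinarith
    rw [hr, ← div_eq_mul_inv, le_div_iff₀ hsn, ← div_eq_inv_mul]
    exact (div_le_iff₀ (hspos _)).2 h3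
  have h1s : 1 ≤ s 1 * (s n)⁻¹ := by
    rw [← div_eq_mul_inv, le_div_iff₀ hsn, one_mul]
    exact hs.anti 1 n le_rfl hn
  set T := ∑ i ∈ Finset.Icc 1 n, |∏ j ∈ Finset.Ioc (i - ℓ i) i, (1 - s j)| with hT
  have hTnn : 0 ≤ T := Finset.sum_nonneg fun _ _ => abs_nonneg _
  have hm := abs_le.1 (hmain (n + 1))
  have ht := abs_le.1 htail
  have hDr := mul_le_mul_of_nonneg_left hr2 hDpos.le
  have hsi := inv_pos.2 hsn
  have h1 : 0 < s 1 := by simpa using hspos 0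
  have h2 : D * ρ ^ 2 * (s n)⁻¹ + s 1 * (s n)⁻¹ + 2 * (G * T)
      ≤ (D * ρ ^ 2 + s 1 + 2 * G) * ((s n)⁻¹ + T) := by
    have a1 : 0 ≤ (D * ρ ^ 2 + s 1) * T := by positivity
    have a2 : 0 ≤ G * (s n)⁻¹ := by positivity
    nlinarith
  rw [hsplit, abs_le]
  constructor <;> linarith

end trace

/-! ### Polynomial steps and logarithmic batches -/

open Filter Topology in
lemma isSlowStep_stepSize {η α : ℝ} (hη : 0 < η) (hα0 : 0 < α) (hα1 : α < 1) :
    IsSlowStep (stepSize η α) where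
  pos i hi := by
    have : (0 : ℝ) < i := by exact_mod_cast hi
    exact mul_pos hη (Real.rpow_pos_of_pos this _)
  anti i j hi hij := by
    have : (0 : ℝ) < i := by exact_mod_cast hi
    refine mul_le_mul_of_nonneg_left ?_ hη.le
    exact Real.rpow_le_rpow_of_nonpos this (by exact_mod_cast hij) (by linarith)
  tendsto := by
    have := ((tendsto_rpow_neg_atTop hα0).comp tendsto_natCast_atTop_atTop).const_mul η
    rw [mul_zero] at this
    exact this
  inv_sub := by
    have e : ∀ i, (stepSize η α i)⁻¹ = η⁻¹ * (i : ℝ) ^ α := fun i => by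
      rw [stepSize, mul_inv, Real.rpow_neg (Nat.cast_nonneg i), inv_inv]
    have hlim : Tendsto (fun i : ℕ => η⁻¹ * (α * (i : ℝ) ^ (-(1 - α)))) atTop (𝓝 0) := by
      have := (((tendsto_rpow_neg_atTop (y := 1 - α) (by linarith)).comp
        tendsto_natCast_atTop_atTop).const_mul α).const_mul η⁻¹
      rw [mul_zero, mul_zero] at this
      exact this
    refine squeeze_zero' (Eventually.of_forall fun i => ?_) ?_ hlim
    · rw [e, e, ← mul_sub]
      refine mul_nonneg (inv_pos.2 hη).le (sub_nonneg.2 ?_)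
      exact Real.rpow_le_rpow (Nat.cast_nonneg i) (by push_cast; linarith) hα0.le
    · filter_upwards [eventually_ge_atTop 1] with i hi
      have hi' : (0 : ℝ) < i := by exact_mod_cast hi
      rw [e, e, ← mul_sub]
      refine mul_le_mul_of_nonneg_left ?_ (inv_pos.2 hη).le
      have h1 : ((i + 1 : ℕ) : ℝ) = i * (1 + 1 / i) := by push_cast; field_simp
      -- Bernoulli's inequality for exponents below 1 bounds the increments of `i ^ α` by `α * i ^
      -- (α - 1)`.
      have h2 : (1 + 1 / (i : ℝ)) ^ α ≤ 1 + α * (1 / i) :=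
        rpow_one_add_le_one_add_mul_self (by have := one_div_pos.2 hi'; linarith) hα0.le hα1.le
      have h3 : (i : ℝ) ^ (-(1 - α)) = i ^ α * (1 / i) := by
        rw [neg_sub, Real.rpow_sub hi', Real.rpow_one]
        ring
      rw [h1, Real.mul_rpow hi'.le (by positivity), h3]
      have := mul_le_mul_of_nonneg_left h2 (Real.rpow_nonneg hi'.le α)
      nlinarith

open Filter in
lemma eventually_rpow_mul_log_le {α ε : ℝ} (hα : α < 1) (hε : 0 < ε) :
    ∀ᶠ n : ℕ in atTop, (n : ℝ) ^ α * Real.log n ≤ ε * n := by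
  have h := (isLittleO_log_rpow_atTop (r := 1 - α) (by linarith)).bound hε
  filter_upwards [tendsto_natCast_atTop_atTop.eventually h, eventually_ge_atTop 1] with n hn h1
  have h1' : (0 : ℝ) < n := by exact_mod_cast h1
  rw [Real.norm_eq_abs, Real.norm_of_nonneg (Real.rpow_nonneg h1'.le _)] at hn
  calc (n : ℝ) ^ α * Real.log n ≤ (n : ℝ) ^ α * (ε * (n : ℝ) ^ (1 - α)) := by
        gcongr
        exact (le_abs_self _).trans hn
    _ = ε * ((n : ℝ) ^ α * (n : ℝ) ^ (1 - α)) := by ring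
    _ = ε * n := by rw [← Real.rpow_add h1']; simp

lemma half_le_log_natCast {n : ℕ} (hn : 2 ≤ n) : 1 / 2 ≤ Real.log n := by
  have h1 : Real.log 2 ≤ Real.log n := Real.log_le_log (by norm_num) (by exact_mod_cast hn)
  have := Real.log_two_gt_d9
  linarith

lemma sub_one_le_batchSize (C α : ℝ) (i : ℕ) :
    C * (i : ℝ) ^ α * Real.log i - 1 ≤ batchSize C α i :=
  (Nat.sub_one_lt_floor _).le

lemma batchSize_le {C α : ℝ} (hC : 0 < C) (i : ℕ) :
    (batchSize C α i : ℝ) ≤ C * (i : ℝ) ^ α * Real.log i :=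
  Nat.floor_le (mul_nonneg (mul_nonneg hC.le (Real.rpow_nonneg (Nat.cast_nonneg i) _))
    (Real.log_natCast_nonneg i))

-- Here `C > 1 / η` enters: eventually the product is at most `exp (-s i * ℓ i)`, and `s i * ℓ i ≥ η
-- * C * log i - s i ≥ log i - 1`, which gives `e / i`.
open Filter in
lemma exists_abs_prod_batch_le {η α C : ℝ} (hη : 0 < η) (hα0 : 0 < α) (hα1 : α < 1)
    (hC : η⁻¹ < C) : ∃ K, 0 < K ∧ ∀ i : ℕ, 1 ≤ i →
      |∏ j ∈ Finset.Ioc (i - batchSize C α i) i, (1 - stepSize η α j)| ≤ K * (i : ℝ)⁻¹ := by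
  have hs := isSlowStep_stepSize hη hα0 hα1
  have hC0 : 0 < C := (inv_pos.2 hη).trans hC
  obtain ⟨m, hm, hm1⟩ := hs.exists_forall_le one_pos
  -- Since `i ^ α * log i = o(i)`, the batch eventually starts after `m`: it is not truncated, and
  -- all its factors are nonnegative.
  have hev : ∀ᶠ i : ℕ in atTop, batchSize C α i + m ≤ i := by
    filter_upwards [eventually_rpow_mul_log_le hα1 (ε := 1 / (2 * C)) (by positivity),
      eventually_ge_atTop (2 * m)] with i hi hi2
    have h1 := batchSize_le (α := α) hC0 i
    have h2 : C * ((i : ℝ) ^ α * Real.log i) ≤ C * (1 / (2 * C) * i) := by gcongr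
    have h3 : C * (1 / (2 * C) * i) = (i : ℝ) / 2 := by field_simp
    have h4 : ((2 * m : ℕ) : ℝ) ≤ i := by exact_mod_cast hi2
    push_cast at h4
    have : ((batchSize C α i + m : ℕ) : ℝ) ≤ i := by push_cast; linarith
    exact_mod_cast this
  obtain ⟨N, hN⟩ := eventually_atTop.1 hev
  obtain ⟨K, hK, h⟩ := exists_bound_of_forall_ge
    (f := fun i : ℕ => |∏ j ∈ Finset.Ioc (i - batchSize C α i) i, (1 - stepSize η α j)| * i)
    (K := Real.exp 1) (m := max N 1) fun i hi => by
      have hiN := hN i (by omega)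
      have hi0 : (0 : ℝ) < i := by exact_mod_cast (show 0 < i by omega)
      have hfac : ∀ j ∈ Finset.Ioc (i - batchSize C α i) i,
          0 ≤ 1 - stepSize η α j ∧ 1 - stepSize η α j ≤ Real.exp (-stepSize η α i) := by
        intro j hj
        rw [Finset.mem_Ioc] at hj
        have h1 := hm1 j (by omega)
        have h2 := hs.anti j i (by omega) hj.2
        have h3 := Real.add_one_le_exp (-stepSize η α i)
        constructor <;> linarith
      rw [abs_of_nonneg (Finset.prod_nonneg fun j hj => (hfac j hj).1)]
      have h1 : ∏ j ∈ Finset.Ioc (i - batchSize C α i) i, (1 - stepSize η α j)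
          ≤ Real.exp (-stepSize η α i) ^ batchSize C α i := by
        refine (Finset.prod_le_prod (fun j hj => (hfac j hj).1)
          fun j hj => (hfac j hj).2).trans (le_of_eq ?_)
        rw [Finset.prod_const, Nat.card_Ioc]
        congr 1
        omega
      have hlog := Real.log_natCast_nonneg i
      have h2 : Real.log i - 1 ≤ stepSize η α i * batchSize C α i := by
        have hsp := hs.pos i (by omega)
        have h3 := mul_le_mul_of_nonneg_left (sub_one_le_batchSize C α i) hsp.le
        have h4 : stepSize η α i * (C * (i : ℝ) ^ α * Real.log i - 1)
            = η * C * Real.log i - stepSize η α i := by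
          have : (i : ℝ) ^ (-α) * (i : ℝ) ^ α = 1 := by
            rw [← Real.rpow_add hi0]; simp
          rw [mul_sub, mul_one]
          congr 1
          rw [stepSize]
          linear_combination (η * C * Real.log i) * this
        have h5 := hm1 i (by omega)
        have h6 : 1 ≤ η * C := by
          have := mul_le_mul_of_nonneg_left hC.le hη.le
          rwa [mul_inv_cancel₀ hη.ne'] at this
        nlinarith
      calc _ ≤ Real.exp (-stepSize η α i) ^ batchSize C α i * i := by gcongr
        _ = Real.exp (-(stepSize η α i * batchSize C α i)) * Real.exp (Real.log i) := by
            rw [← Real.exp_nat_mul, Real.exp_log hi0]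
            congr 2
            ring
        _ ≤ Real.exp 1 := by
            rw [← Real.exp_add, Real.exp_le_exp]
            linarith
  refine ⟨K, hK, fun i hi => ?_⟩
  have hi0 : (0 : ℝ) < i := by exact_mod_cast hi
  rw [← div_eq_mul_inv, le_div_iff₀ hi0]
  exact h i

lemma exists_sum_sq_oracleForm_le {η α C : ℝ} (hη : 0 < η) (hα0 : 0 < α) (hα1 : α < 1)
    (hC : 0 < C) : ∃ K, 0 < K ∧ ∀ n : ℕ, 2 ≤ n →
      ∑ a ∈ Finset.range n, ∑ b ∈ Finset.range n,
        (oracleForm (stepSize η α) (batchSize C α) n a b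
          + oracleForm (stepSize η α) (batchSize C α) n b a) ^ 2
        ≤ K * (n * ((n : ℝ) ^ α * Real.log n)) := by
  obtain ⟨K, hK, hrow, hcol⟩ := (isSlowStep_stepSize hη hα0 hα1).exists_sum_abs_response_le
  -- The extra 2 absorbs the summand 1, as `log n ≥ 1 / 2` for `n ≥ 2`.
  refine ⟨12 * K ^ 4 * (2 * C + 2), by positivity, fun n hn => ?_⟩
  refine (sum_sq_oracleForm_le (batchSize C α) hK hrow hcol n).trans ?_
  refine (mul_le_mul_of_nonneg_left ?_ (show 0 ≤ 12 * K ^ 4 by positivity)).trans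
    (mul_assoc _ _ _).ge
  have hn1 : (1 : ℝ) ≤ n := by exact_mod_cast (show 1 ≤ n by omega)
  have hpow : 1 ≤ (n : ℝ) ^ α := Real.one_le_rpow hn1 hα0.le
  have hlog := half_le_log_natCast hn
  calc ∑ i ∈ Finset.Icc 1 n, (2 * (batchSize C α i : ℝ) + 1)
      ≤ ∑ i ∈ Finset.Icc 1 n, (2 * C + 2) * ((n : ℝ) ^ α * Real.log n) := by
        refine Finset.sum_le_sum fun i hi => ?_
        rw [Finset.mem_Icc] at hi
        have hi0 : (0 : ℝ) < i := by exact_mod_cast (show 0 < i by omega)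
        have hin : (i : ℝ) ≤ n := by exact_mod_cast hi.2
        have h1 := batchSize_le (α := α) hC i
        have h2 : C * (i : ℝ) ^ α * Real.log i ≤ C * (n : ℝ) ^ α * Real.log n := by
          have := Real.log_natCast_nonneg i
          gcongr
        nlinarith
    _ = _ := by simp; ring

lemma exists_abs_sum_oracleForm_diag_sub_le {η α C : ℝ} (hη : 0 < η) (hα0 : 0 < α)
    (hα1 : α < 1) (hC : η⁻¹ < C) : ∃ K, 0 < K ∧ ∀ n : ℕ, 2 ≤ n →
      |∑ a ∈ Finset.range n, oracleForm (stepSize η α) (batchSize C α) n a a - n|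
        ≤ K * (n : ℝ) ^ α := by
  obtain ⟨K₁, hK₁, h1⟩ :=
    (isSlowStep_stepSize hη hα0 hα1).exists_abs_sum_oracleForm_diag_sub_le
  obtain ⟨K₂, hK₂, h2⟩ := exists_abs_prod_batch_le hη hα0 hα1 hC
  refine ⟨K₁ * (η⁻¹ + K₂ * (1 + α⁻¹)), by positivity, fun n hn => ?_⟩
  refine (h1 (batchSize C α) n (by omega)).trans ?_
  rw [mul_assoc]
  refine mul_le_mul_of_nonneg_left ?_ hK₁.le
  have hn1 : (1 : ℝ) ≤ n := by exact_mod_cast (show 1 ≤ n by omega)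
  have hpow : 1 ≤ (n : ℝ) ^ α := Real.one_le_rpow hn1 hα0.le
  have e : (stepSize η α n)⁻¹ = η⁻¹ * (n : ℝ) ^ α := by
    rw [stepSize, mul_inv, Real.rpow_neg (Nat.cast_nonneg n), inv_inv]
  have hsum : ∑ i ∈ Finset.Icc 1 n,
      |∏ j ∈ Finset.Ioc (i - batchSize C α i) i, (1 - stepSize η α j)|
      ≤ K₂ * ((1 + α⁻¹) * (n : ℝ) ^ α) := by
    calc _ ≤ ∑ i ∈ Finset.Icc 1 n, K₂ * (i : ℝ)⁻¹ :=
          Finset.sum_le_sum fun i hi => h2 i (Finset.mem_Icc.1 hi).1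
      _ = K₂ * (harmonic n : ℝ) := by
          rw [← Finset.mul_sum, harmonic_eq_sum_Icc]
          push_cast
          rfl
      _ ≤ K₂ * ((1 + α⁻¹) * (n : ℝ) ^ α) := by
          refine mul_le_mul_of_nonneg_left ?_ hK₂.le
          have h3 := harmonic_le_one_add_log n
          have h4 := Real.log_le_rpow_div (Nat.cast_nonneg n) hα0
          rw [div_eq_mul_inv] at h4
          nlinarith
  rw [e]
  linarith

/-! ### Upper bound for the mean squared error -/

/-- The mean squared error of the oracle estimator for observations of variance `v`. -/
noncomputable def oracleMSE (η α C v : ℝ) (n : ℕ) : ℝ :=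
  (v * ∑ a ∈ Finset.range n, 1 / n * oracleForm (stepSize η α) (batchSize C α) n a a - v) ^ 2
    + v ^ 2 / 2 * ∑ a ∈ Finset.range n, ∑ b ∈ Finset.range n,
      (1 / n * oracleForm (stepSize η α) (batchSize C α) n a b
        + 1 / n * oracleForm (stepSize η α) (batchSize C α) n b a) ^ 2

lemma oracleMSE_eq {η α C v : ℝ} {n : ℕ} (hn : 1 ≤ n) : oracleMSE η α C v n
    = v ^ 2 / (n : ℝ) ^ 2 * ((∑ a ∈ Finset.range n,
        oracleForm (stepSize η α) (batchSize C α) n a a - n) ^ 2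
      + 1 / 2 * ∑ a ∈ Finset.range n, ∑ b ∈ Finset.range n,
        (oracleForm (stepSize η α) (batchSize C α) n a b
          + oracleForm (stepSize η α) (batchSize C α) n b a) ^ 2) := by
  have hn0 : (n : ℝ) ≠ 0 := by exact_mod_cast (show n ≠ 0 by omega)
  rw [oracleMSE]
  simp_rw [← mul_add, mul_pow, ← Finset.mul_sum]
  field_simp

lemma exists_oracleMSE_le {η α C : ℝ} (v : ℝ) (hη : 0 < η) (hα0 : 0 < α) (hα1 : α < 1)
    (hC : η⁻¹ < C) : ∃ c, 0 < c ∧ ∀ n : ℕ, 2 ≤ n →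
      oracleMSE η α C v n ≤ c * ((n : ℝ) ^ (α - 1) * Real.log n) := by
  obtain ⟨K₁, hK₁, h1⟩ := exists_abs_sum_oracleForm_diag_sub_le hη hα0 hα1 hC
  obtain ⟨K₂, hK₂, h2⟩ :=
    exists_sum_sq_oracleForm_le hη hα0 hα1 ((inv_pos.2 hη).trans hC)
  -- `v ^ 2 + 1` keeps the constant positive even for `v = 0`.
  refine ⟨(v ^ 2 + 1) * (2 * K₁ ^ 2 + K₂), by positivity, fun n hn => ?_⟩
  have hn0 : (0 : ℝ) < n := by exact_mod_cast (show 0 < n by omega)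
  have hn1 : (1 : ℝ) ≤ n := by exact_mod_cast (show 1 ≤ n by omega)
  have hlog := half_le_log_natCast hn
  have hpow : (n : ℝ) ^ α ≤ n := by
    simpa using Real.rpow_le_rpow_of_exponent_le hn1 hα1.le
  have hpp := Real.rpow_pos_of_pos hn0 α
  have h3 : (∑ a ∈ Finset.range n, oracleForm (stepSize η α) (batchSize C α) n a a - n) ^ 2
      ≤ 2 * K₁ ^ 2 * (n * ((n : ℝ) ^ α * Real.log n)) := by
    calc _ ≤ (K₁ * (n : ℝ) ^ α) ^ 2 := sq_le_sq' (abs_le.1 (h1 n hn)).1 (abs_le.1 (h1 n hn)).2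
      _ = K₁ ^ 2 * ((n : ℝ) ^ α * (n : ℝ) ^ α) := by ring
      _ ≤ K₁ ^ 2 * (n * ((n : ℝ) ^ α * (2 * Real.log n))) := by
          refine mul_le_mul_of_nonneg_left ?_ (sq_nonneg _)
          refine mul_le_mul hpow ?_ hpp.le hn0.le
          nlinarith
      _ = _ := by ring
  have h4 := h2 n hn
  have hL : 0 ≤ n * ((n : ℝ) ^ α * Real.log n) := by positivity
  rw [oracleMSE_eq (by omega)]
  calc _ ≤ v ^ 2 / (n : ℝ) ^ 2 * ((2 * K₁ ^ 2 + K₂) * (n * ((n : ℝ) ^ α * Real.log n))) := by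
        refine mul_le_mul_of_nonneg_left ?_ (by positivity)
        nlinarith
    _ = v ^ 2 * (2 * K₁ ^ 2 + K₂) * ((n : ℝ) ^ (α - 1) * Real.log n) := by
        rw [Real.rpow_sub hn0, Real.rpow_one]
        field_simp
    _ ≤ _ := by
        refine mul_le_mul_of_nonneg_right ?_ (by positivity)
        nlinarith [sq_nonneg K₁]

/-! ### Lower bound for the norm of the form -/

section lowerBound

variable {s : ℕ → ℝ}

lemma response_nonneg {m a : ℕ} (hpos : ∀ i, 1 ≤ i → 0 < s i) (hle : ∀ i, m ≤ i → s i ≤ 1)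
    (ha : m ≤ a) (i : ℕ) : 0 ≤ response s i a := by
  induction i with
  | zero => exact le_rfl
  | succ i ih =>
    rcases lt_trichotomy a i with h | h | h
    · rw [response_succ_of_lt h]
      exact mul_nonneg (by linarith [hle (i + 1) (by omega)]) ih
    · rw [← h, response_self]
      exact (hpos _ (by omega)).le
    · rw [response_eq_zero (by omega)]

/-- A product of `k` factors `1 - s j` with `s j ≤ S` is at least `1 - S * k`. -/
lemma mul_le_response_add {S : ℝ} {a k : ℕ} (hS : S * k ≤ 1) (hpos : ∀ i, 1 ≤ i → 0 < s i)
    (hs : ∀ i, a + 1 ≤ i → i ≤ a + 1 + k → s i ≤ S) (hS1 : S ≤ 1) :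
    s (a + 1) * (1 - S * k) ≤ response s (a + 1 + k) a := by
  induction k with
  | zero => simp [response_self]
  | succ k ih =>
    have h0 := hpos (a + 1) (by omega)
    have h1 := hpos (a + 1 + k + 1) (by omega)
    have h2 := hs (a + 1 + k + 1) (by omega) (by omega)
    push_cast at hS ⊢
    have hSk : S * k ≤ 1 := by linarith
    have h3 := ih hSk fun i hi hi' => hs i hi (by omega)
    rw [← add_assoc, response_succ_of_lt (by omega)]
    refine le_trans ?_ (mul_le_mul_of_nonneg_left h3 (by linarith))
    have hk : 0 ≤ S * k := mul_nonneg (h1.le.trans h2) (Nat.cast_nonneg k)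
    have h4 : 1 - S * (k + 1) ≤ (1 - s (a + 1 + k + 1)) * (1 - S * k) := by nlinarith
    nlinarith

lemma le_sum_Ioc_response {S σ₀ : ℝ} {a L n : ℕ} (hS : S * L ≤ 1 / 2)
    (hpos : ∀ i, 1 ≤ i → 0 < s i) (hs : ∀ i, a + 1 ≤ i → i ≤ n → s i ≤ S) (hS1 : S ≤ 1)
    (hlow : σ₀ ≤ s (a + 1)) (hσ : 0 ≤ σ₀) (hn : a + L ≤ n) :
    L * (σ₀ / 2) ≤ ∑ k ∈ Finset.Ioc a (a + L), response s k a := by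
  have h : ∀ k ∈ Finset.Ioc a (a + L), σ₀ / 2 ≤ response s k a := by
    intro k hk
    rw [Finset.mem_Ioc] at hk
    obtain ⟨d, rfl⟩ := Nat.exists_eq_add_of_le (show a + 1 ≤ k from hk.1)
    have hS0 : 0 ≤ S := (hpos (a + 1) (by omega)).le.trans (hs (a + 1) le_rfl (by omega))
    have hd : (d : ℝ) ≤ L := by exact_mod_cast (show d ≤ L by omega)
    have h1 := mul_le_mul_of_nonneg_left hd hS0
    have h2 := mul_le_response_add (s := s) (S := S) (a := a) (k := d) (by linarith) hpos
      (fun i hi hi' => hs i hi (by omega)) hS1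
    have h3 : σ₀ * (1 / 2) ≤ s (a + 1) * (1 - S * d) :=
      mul_le_mul hlow (by linarith) (by norm_num) (hσ.trans hlow)
    linarith
  calc _ = ∑ k ∈ Finset.Ioc a (a + L), σ₀ / 2 := by simp
    _ ≤ _ := Finset.sum_le_sum h

/-- Grouped so that no cancellation remains: a nonempty batch ending at `i` contains `i`, hence for
nonnegative responses both summands are nonnegative. -/
lemma oracleForm_add_swap (ℓ : ℕ → ℕ) (n a b : ℕ) :
    oracleForm s ℓ n a b + oracleForm s ℓ n b a
      = 2 * ∑ i ∈ Finset.Icc 1 n, (response s i a * batchResponse s ℓ i b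
        + response s i b * (batchResponse s ℓ i a - response s i a)) := by
  rw [oracleForm, oracleForm, ← Finset.sum_add_distrib, Finset.mul_sum]
  refine Finset.sum_congr rfl fun i _ => ?_
  ring

/-- For `i` in `(a, a + L]` the batch still covers `(b, b + L]`. The responses to `a` and to `b`,
summed over these windows, are each at least `L * σ₀ / 2`. -/
lemma le_oracleForm_add_swap {S σ₀ : ℝ} {m a b L n : ℕ} {ℓ : ℕ → ℕ} (hS : S * L ≤ 1 / 2)
    (hpos : ∀ i, 1 ≤ i → 0 < s i) (hle : ∀ i, m ≤ i → s i ≤ 1)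
    (hs : ∀ i, m ≤ i → i ≤ n → s i ≤ S) (hS1 : S ≤ 1) (hσ : 0 ≤ σ₀)
    (hlow : ∀ i, m ≤ i → i ≤ n → σ₀ ≤ s i) (hb : m ≤ b) (hab : b + L ≤ a) (hn : a + L ≤ n)
    (hL : 1 ≤ L)
    (hℓ : ∀ i, m ≤ i → i ≤ n → a + L - b ≤ ℓ i) :
    2 * (L * (σ₀ / 2)) ^ 2 ≤ oracleForm s ℓ n a b + oracleForm s ℓ n b a := by
  have hca := response_nonneg hpos hle (show m ≤ a by omega)
  have hcb := response_nonneg hpos hle hb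
  have hBb : ∀ i, 0 ≤ batchResponse s ℓ i b := fun i => Finset.sum_nonneg fun k _ => hcb k
  have hBa : ∀ i, i ≤ n → response s i a ≤ batchResponse s ℓ i a := by
    intro i hi
    rcases le_or_gt i a with h | h
    · rw [response_eq_zero h]
      exact Finset.sum_nonneg fun k _ => hca k
    · have := hℓ i (by omega) hi
      exact Finset.single_le_sum (f := fun k => response s k a) (fun k _ => hca k)
        (Finset.mem_Ioc.2 ⟨by omega, le_rfl⟩)
  have hwin : ∀ i ∈ Finset.Ioc a (a + L), L * (σ₀ / 2) ≤ batchResponse s ℓ i b := by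
    intro i hi
    rw [Finset.mem_Ioc] at hi
    have h1 := hℓ i (by omega) (by omega)
    refine (le_sum_Ioc_response hS hpos (fun j hj hj' => hs j (by omega) hj') hS1
      (hlow (b + 1) (by omega) (by omega)) hσ (show b + L ≤ n by omega)).trans ?_
    refine Finset.sum_le_sum_of_subset_of_nonneg (fun k hk => ?_) fun k _ _ => hcb k
    rw [Finset.mem_Ioc] at hk ⊢
    omega
  have hL0 : 0 ≤ L * (σ₀ / 2) := by positivity
  rw [oracleForm_add_swap]
  refine mul_le_mul_of_nonneg_left ?_ (by norm_num)
  calc (L * (σ₀ / 2)) ^ 2 = L * (σ₀ / 2) * (L * (σ₀ / 2)) := sq _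
    _ ≤ (∑ i ∈ Finset.Ioc a (a + L), response s i a) * (L * (σ₀ / 2)) :=
        mul_le_mul_of_nonneg_right (le_sum_Ioc_response hS hpos
          (fun j hj hj' => hs j (by omega) hj') hS1 (hlow (a + 1) (by omega) (by omega)) hσ hn) hL0
    _ ≤ ∑ i ∈ Finset.Ioc a (a + L), response s i a * batchResponse s ℓ i b := by
        rw [Finset.sum_mul]
        exact Finset.sum_le_sum fun i hi => mul_le_mul_of_nonneg_left (hwin i hi) (hca i)
    _ ≤ ∑ i ∈ Finset.Icc 1 n, response s i a * batchResponse s ℓ i b := by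
        refine Finset.sum_le_sum_of_subset_of_nonneg (fun k hk => ?_)
          fun k _ _ => mul_nonneg (hca k) (hBb k)
        rw [Finset.mem_Ioc] at hk
        rw [Finset.mem_Icc]
        omega
    _ ≤ _ := by
        refine Finset.sum_le_sum fun i hi => ?_
        have := mul_nonneg (hcb i) (sub_nonneg.2 (hBa i (Finset.mem_Icc.1 hi).2))
        linarith

/-- Counts `q` values of `b`, each with `T` values of `a` between `b + L` and `b + L + T`. -/
lemma le_sum_sq_oracleForm {S σ₀ : ℝ} {m L q T n : ℕ} {ℓ : ℕ → ℕ} (hS : S * L ≤ 1 / 2)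
    (hpos : ∀ i, 1 ≤ i → 0 < s i) (hle : ∀ i, m ≤ i → s i ≤ 1)
    (hs : ∀ i, m ≤ i → i ≤ n → s i ≤ S) (hS1 : S ≤ 1) (hσ : 0 ≤ σ₀)
    (hlow : ∀ i, m ≤ i → i ≤ n → σ₀ ≤ s i) (hL : 1 ≤ L) (hn : m + q + 2 * L + T ≤ n)
    (hℓ : ∀ i, m ≤ i → i ≤ n → 2 * L + T ≤ ℓ i) :
    q * T * (2 * (L * (σ₀ / 2)) ^ 2) ^ 2 ≤ ∑ a ∈ Finset.range n, ∑ b ∈ Finset.range n,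
        (oracleForm s ℓ n a b + oracleForm s ℓ n b a) ^ 2 := by
  rw [Finset.sum_comm]
  calc q * T * (2 * (L * (σ₀ / 2)) ^ 2) ^ 2
      = ∑ b ∈ Finset.Ico m (m + q), ∑ a ∈ Finset.Ico (b + L) (b + L + T),
        (2 * (L * (σ₀ / 2)) ^ 2) ^ 2 := by simp; ring
    _ ≤ ∑ b ∈ Finset.Ico m (m + q), ∑ a ∈ Finset.Ico (b + L) (b + L + T),
        (oracleForm s ℓ n a b + oracleForm s ℓ n b a) ^ 2 := by
        refine Finset.sum_le_sum fun b hb => Finset.sum_le_sum fun a ha => ?_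
        rw [Finset.mem_Ico] at hb ha
        refine pow_le_pow_left₀ (by positivity) ?_ 2
        refine le_oracleForm_add_swap hS hpos hle hs hS1 hσ hlow hb.1 ha.1 (by omega) hL
          fun i hi hi' => ?_
        have := hℓ i hi hi'
        omega
    _ ≤ ∑ b ∈ Finset.Ico m (m + q), ∑ a ∈ Finset.range n,
        (oracleForm s ℓ n a b + oracleForm s ℓ n b a) ^ 2 := by
        refine Finset.sum_le_sum fun b hb => ?_
        rw [Finset.mem_Ico] at hb
        refine Finset.sum_le_sum_of_subset_of_nonneg (fun a ha => ?_) fun _ _ _ => sq_nonneg _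
        rw [Finset.mem_Ico] at ha
        rw [Finset.mem_range]
        omega
    _ ≤ _ := by
        refine Finset.sum_le_sum_of_subset_of_nonneg (fun a ha => ?_)
          fun _ _ _ => Finset.sum_nonneg fun _ _ => sq_nonneg _
        rw [Finset.mem_Ico] at ha
        rw [Finset.mem_range]
        omega

/-- Only the last iterate sees the last observation, so the corner entry is `± s n ^ 2`, negative
exactly when the last batch is empty. This handles the small `n` in the lower bound. -/
lemma sum_sq_oracleForm_pos (hpos : ∀ i, 1 ≤ i → 0 < s i) (ℓ : ℕ → ℕ) {n : ℕ} (hn : 1 ≤ n) :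
    0 < ∑ a ∈ Finset.range n, ∑ b ∈ Finset.range n,
        (oracleForm s ℓ n a b + oracleForm s ℓ n b a) ^ 2 := by
  obtain ⟨m, rfl⟩ := Nat.exists_eq_add_of_le' hn
  have hp := hpos (m + 1) hn
  have hB : batchResponse s ℓ (m + 1) m = s (m + 1) ∨ batchResponse s ℓ (m + 1) m = 0 := by
    rcases Nat.eq_zero_or_pos (ℓ (m + 1)) with h | h
    · right
      simp [batchResponse, h]
    · left
      rw [batchResponse, Finset.sum_eq_single (m + 1), response_self]
      · intro k hk hk'
        rw [Finset.mem_Ioc] at hk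
        exact response_eq_zero (by omega)
      · intro h'
        exact absurd (Finset.mem_Ioc.2 ⟨by omega, le_rfl⟩) h'
  have hdiag : oracleForm s ℓ (m + 1) m m
      = 2 * s (m + 1) * batchResponse s ℓ (m + 1) m - s (m + 1) * s (m + 1) := by
    rw [oracleForm, Finset.sum_eq_single (m + 1), response_self]
    · intro i hi hi'
      rw [Finset.mem_Icc] at hi
      rw [response_eq_zero (show i ≤ m by omega)]
      simp
    · intro h
      exact absurd (Finset.mem_Icc.2 ⟨by omega, le_rfl⟩) h
  have hne : 0 < (oracleForm s ℓ (m + 1) m m + oracleForm s ℓ (m + 1) m m) ^ 2 := by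
    rw [hdiag]
    rcases hB with h | h
    · rw [h]
      have : 0 < s (m + 1) * s (m + 1) := mul_pos hp hp
      exact pow_pos (by linarith) 2
    · rw [h, ← neg_sq]
      have : 0 < s (m + 1) * s (m + 1) := mul_pos hp hp
      exact pow_pos (by linarith) 2
  refine hne.trans_le ?_
  have hm : m ∈ Finset.range (m + 1) := Finset.self_mem_range_succ m
  refine le_trans ?_ (Finset.single_le_sum (f := fun a => ∑ b ∈ Finset.range (m + 1),
    (oracleForm s ℓ (m + 1) a b + oracleForm s ℓ (m + 1) b a) ^ 2)
    (fun _ _ => Finset.sum_nonneg fun _ _ => sq_nonneg _) hm)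
  exact Finset.single_le_sum (f := fun b =>
    (oracleForm s ℓ (m + 1) m b + oracleForm s ℓ (m + 1) b m) ^ 2) (fun _ _ => sq_nonneg _) hm

end lowerBound

-- All indices are taken in `[n/2, n]`, where steps are comparable to `n ^ (-α)`; windows have
-- length `L ≈ δ * n ^ α`, and `T ≈ τ * n ^ α * log n`.
open Filter in
lemma eventually_le_sum_sq_oracleForm {η α C : ℝ} (hη : 0 < η) (hα0 : 0 < α) (hα1 : α < 1)
    (hC : 0 < C) : ∃ c, 0 < c ∧ ∀ᶠ n : ℕ in atTop, c * (n * ((n : ℝ) ^ α * Real.log n))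
      ≤ ∑ a ∈ Finset.range n, ∑ b ∈ Finset.range n,
        (oracleForm (stepSize η α) (batchSize C α) n a b
          + oracleForm (stepSize η α) (batchSize C α) n b a) ^ 2 := by
  have hs := isSlowStep_stepSize hη hα0 hα1
  obtain ⟨m₁, hm₁, hle⟩ := hs.exists_forall_le one_pos
  -- Chosen so that `S * L ≤ 3 * η * δ = 1 / 2`.
  set δ := 1 / (6 * η) with hδ
  have hδ0 : 0 < δ := by positivity
  -- Batches in the range have length at least `C / 6 * p * log n - 1`; `C / 8` of this pays for `2
  -- * L + 1`, and `C / 24` is left for `T`.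
  set τ := C / 24 with hτ
  have hτ0 : 0 < τ := by positivity
  have hpowT : Tendsto (fun n : ℕ => (n : ℝ) ^ α) atTop atTop :=
    (tendsto_rpow_atTop hα0).comp tendsto_natCast_atTop_atTop
  have hlogT : Tendsto (fun n : ℕ => Real.log n) atTop atTop :=
    Real.tendsto_log_atTop.comp tendsto_natCast_atTop_atTop
  refine ⟨1 / 8 * (τ / 2) * (1 / 288) ^ 2, by positivity, ?_⟩
  filter_upwards [eventually_ge_atTop (2 * m₁ + 9), hpowT.eventually_ge_atTop (1 / δ),
    hpowT.eventually_ge_atTop (1 / τ), hpowT.eventually_ge_atTop (3 * η),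
    hlogT.eventually_ge_atTop ((2 * δ + 1) * (8 / C)), hlogT.eventually_ge_atTop 1,
    eventually_rpow_mul_log_le hα1 (ε := 1 / (4 * (2 * δ + τ))) (by positivity)]
    with n hn hp1 hp2 hp3 hl1 hl2 hsub
  have hn9 : (9 : ℝ) ≤ n := by exact_mod_cast (show 9 ≤ n by omega)
  have hn0 : (0 : ℝ) < n := by linarith
  set p := (n : ℝ) ^ α with hp
  have hp0 : 0 < p := Real.rpow_pos_of_pos hn0 α
  have hpone : 1 ≤ p := Real.one_le_rpow (by linarith) hα0.le
  have hpinv : (n : ℝ) ^ (-α) = p⁻¹ := Real.rpow_neg hn0.le α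
  set L := ⌊δ * p⌋₊ with hLdef
  set T := ⌊τ * (p * Real.log n)⌋₊ with hTdef
  have hδp : 1 ≤ δ * p := by rwa [div_le_iff₀' hδ0] at hp1
  have hτp : 1 ≤ τ * (p * Real.log n) := by
    rw [div_le_iff₀' hτ0] at hp2
    nlinarith
  have hL1 : 1 ≤ L := Nat.one_le_floor_iff _ |>.2 hδp
  have hLle : (L : ℝ) ≤ δ * p := Nat.floor_le (by positivity)
  have hLge : δ * p / 2 ≤ L := by
    have h1 := Nat.sub_one_lt_floor (δ * p)
    have h2 : (1 : ℝ) ≤ L := by exact_mod_cast hL1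
    linarith
  have hT1 : 1 ≤ T := Nat.one_le_floor_iff _ |>.2 hτp
  have hTle : (T : ℝ) ≤ τ * (p * Real.log n) := Nat.floor_le (by linarith)
  have hTge : τ * (p * Real.log n) / 2 ≤ T := by
    have h1 := Nat.sub_one_lt_floor (τ * (p * Real.log n))
    have h2 : (1 : ℝ) ≤ T := by exact_mod_cast hT1
    linarith
  -- `n / 2` is rounded down, hence `n / 3` in the real bound.
  have hthird : ∀ i : ℕ, n / 2 ≤ i → (n : ℝ) / 3 ≤ i := by
    intro i hi
    have : ((n : ℕ) : ℝ) ≤ 3 * i := by exact_mod_cast (show n ≤ 3 * i by omega)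
    linarith
  have hpow3 : ∀ x : ℝ, 1 ≤ x → x ^ α ≤ x := fun x hx => by
    simpa using Real.rpow_le_rpow_of_exponent_le hx hα1.le
  have hpthird : p / 3 ≤ ((n : ℝ) / 3) ^ α := by
    rw [Real.div_rpow hn0.le (by norm_num)]
    exact div_le_div_of_nonneg_left hp0.le (by positivity) (hpow3 3 (by norm_num))
  have hipow : ∀ i : ℕ, n / 2 ≤ i → p / 3 ≤ (i : ℝ) ^ α := fun i hi =>
    hpthird.trans (Real.rpow_le_rpow (by positivity) (hthird i hi) hα0.le)
  have hkey := le_sum_sq_oracleForm (s := stepSize η α) (S := 3 * η * p⁻¹) (σ₀ := η * p⁻¹)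
    (m := n / 2) (L := L) (q := n / 4) (T := T) (n := n) (ℓ := batchSize C α)
    (by
      calc 3 * η * p⁻¹ * L ≤ 3 * η * p⁻¹ * (δ * p) := by gcongr
        _ = 1 / 2 := by rw [hδ]; field_simp; norm_num)
    hs.pos (fun i hi => hle i (by omega))
    (fun i hi _ => by
      have h1 := hipow i hi
      rw [stepSize, Real.rpow_neg (Nat.cast_nonneg i), mul_comm 3 η, mul_assoc]
      refine mul_le_mul_of_nonneg_left ?_ hη.le
      have := inv_anti₀ (by positivity) h1
      rwa [inv_div, div_eq_mul_inv] at this)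
    (by rwa [← div_eq_mul_inv, div_le_one hp0])
    (by positivity)
    (fun i hi hi' => by
      rw [stepSize, ← hpinv]
      refine mul_le_mul_of_nonneg_left ?_ hη.le
      exact Real.rpow_le_rpow_of_nonpos (by exact_mod_cast (show 0 < i by omega))
        (by exact_mod_cast hi') (by linarith))
    hL1
    (by
      have h1 : (2 * δ + τ) * (p * Real.log n) ≤ n / 4 := by
        calc _ ≤ (2 * δ + τ) * (1 / (4 * (2 * δ + τ)) * n) := by gcongr
          _ = n / 4 := by field_simp
      have h2 : 2 * (L : ℝ) + T ≤ n / 4 := by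
        have : δ * p ≤ δ * (p * Real.log n) := by
          refine mul_le_mul_of_nonneg_left ?_ hδ0.le
          nlinarith
        linarith
      have h3 : (((2 * L + T) * 4 : ℕ) : ℝ) ≤ n := by push_cast; linarith
      have h4 : (2 * L + T) * 4 ≤ n := by exact_mod_cast h3
      omega)
    (fun i hi hi' => by
      have h1 := sub_one_le_batchSize C α i
      have h2 := hipow i hi
      have h3 : Real.log n / 2 ≤ Real.log i := by
        have e1 : Real.log ((n : ℝ) / 3) ≤ Real.log i :=
          Real.log_le_log (by positivity) (hthird i hi)
        have e2 : Real.log 9 ≤ Real.log n := Real.log_le_log (by norm_num) hn9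
        have e3 : Real.log 9 = 2 * Real.log 3 := by
          rw [show (9 : ℝ) = 3 ^ 2 by norm_num, Real.log_pow]; norm_num
        rw [Real.log_div hn0.ne' (by norm_num)] at e1
        linarith
      have h4 : C * (p / 3) * (Real.log n / 2) ≤ C * (i : ℝ) ^ α * Real.log i := by
        gcongr
      have h5 : 2 * δ + 1 ≤ C / 8 * Real.log n := by
        have := mul_le_mul_of_nonneg_left hl1 (show 0 ≤ C / 8 by positivity)
        have e : C / 8 * ((2 * δ + 1) * (8 / C)) = 2 * δ + 1 := by field_simp
        linarith
      have h6 : 2 * δ * p + 1 ≤ C / 8 * (p * Real.log n) := by nlinarith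
      have h7 : ((2 * L + T : ℕ) : ℝ) ≤ batchSize C α i := by
        push_cast
        rw [hτ] at hTle
        nlinarith
      exact_mod_cast h7)
  refine le_trans ?_ hkey
  have hq : (n : ℝ) / 8 ≤ (n / 4 : ℕ) := by
    have : ((n : ℕ) : ℝ) ≤ 8 * (n / 4 : ℕ) := by exact_mod_cast (show n ≤ 8 * (n / 4) by omega)
    linarith
  -- `L * σ₀ / 2 ≥ δ * η / 4 = 1 / 24`, and `2 * (1 / 24) ^ 2 = 1 / 288`.
  have hκ : 1 / 288 ≤ 2 * (L * (η * p⁻¹ / 2)) ^ 2 := by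
    have h1 : 1 / 24 ≤ L * (η * p⁻¹ / 2) := by
      calc (1 : ℝ) / 24 = δ * p / 2 * (η * p⁻¹ / 2) := by rw [hδ]; field_simp; norm_num
        _ ≤ L * (η * p⁻¹ / 2) := mul_le_mul_of_nonneg_right hLge (by positivity)
    calc (1 : ℝ) / 288 = 2 * (1 / 24) ^ 2 := by norm_num
      _ ≤ _ := mul_le_mul_of_nonneg_left (pow_le_pow_left₀ (by norm_num) h1 2) (by norm_num)
  calc 1 / 8 * (τ / 2) * (1 / 288) ^ 2 * (n * (p * Real.log n))
      = n / 8 * (τ * (p * Real.log n) / 2) * (1 / 288) ^ 2 := by ring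
    _ ≤ (n / 4 : ℕ) * T * (2 * (L * (η * p⁻¹ / 2)) ^ 2) ^ 2 :=
        mul_le_mul (mul_le_mul hq hTge (by positivity) (Nat.cast_nonneg _))
          (pow_le_pow_left₀ (by norm_num) hκ 2) (by norm_num) (by positivity)

lemma exists_le_oracleMSE {η α C v : ℝ} (hη : 0 < η) (hα0 : 0 < α) (hα1 : α < 1)
    (hC : 0 < C) (hv : 0 < v) : ∃ c, 0 < c ∧ ∀ n : ℕ, 2 ≤ n →
      c * ((n : ℝ) ^ (α - 1) * Real.log n) ≤ oracleMSE η α C v n := by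
  obtain ⟨c, hc, hev⟩ := eventually_le_sum_sq_oracleForm (C := C) hη hα0 hα1 hC
  obtain ⟨N, hN⟩ := Filter.eventually_atTop.1 hev
  have hMSE : ∀ n : ℕ, 2 ≤ n → v ^ 2 / (n : ℝ) ^ 2 * (1 / 2 * ∑ a ∈ Finset.range n,
      ∑ b ∈ Finset.range n, (oracleForm (stepSize η α) (batchSize C α) n a b
        + oracleForm (stepSize η α) (batchSize C α) n b a) ^ 2) ≤ oracleMSE η α C v n := by
    intro n hn
    rw [oracleMSE_eq (by omega)]
    refine mul_le_mul_of_nonneg_left ?_ (by positivity)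
    linarith [sq_nonneg (∑ a ∈ Finset.range n,
      oracleForm (stepSize η α) (batchSize C α) n a a - n)]
  have hpos : ∀ n : ℕ, 2 ≤ n → 0 < oracleMSE η α C v n := by
    intro n hn
    have hn0 : (0 : ℝ) < n := by exact_mod_cast (show 0 < n by omega)
    refine lt_of_lt_of_le ?_ (hMSE n hn)
    have := sum_sq_oracleForm_pos (isSlowStep_stepSize hη hα0 hα1).pos (batchSize C α)
      (show 1 ≤ n by omega)
    positivity
  -- Bounding the inverse ratio from above makes the eventual lower bound uniform, since the error
  -- is positive for every `n ≥ 2`.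
  obtain ⟨K, hK, h⟩ := exists_bound_of_forall_ge
    (f := fun n : ℕ => (n : ℝ) ^ (α - 1) * Real.log n / oracleMSE η α C v n)
    (K := (v ^ 2 * c / 2)⁻¹) (m := max N 2) fun n hn => by
      have hn0 : (0 : ℝ) < n := by exact_mod_cast (show 0 < n by omega)
      rw [div_le_iff₀ (hpos n (by omega)), ← div_eq_inv_mul, le_div_iff₀ (by positivity)]
      refine le_trans (le_of_eq ?_) ((mul_le_mul_of_nonneg_left (mul_le_mul_of_nonneg_left
        (hN n (by omega)) (by norm_num : (0 : ℝ) ≤ 1 / 2))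
        (by positivity : 0 ≤ v ^ 2 / (n : ℝ) ^ 2)).trans (hMSE n (by omega)))
      rw [Real.rpow_sub hn0, Real.rpow_one]
      field_simp
  refine ⟨K⁻¹, inv_pos.2 hK, fun n hn => ?_⟩
  have := h n
  rw [div_le_iff₀ (hpos n hn)] at this
  rwa [← div_eq_inv_mul, div_le_iff₀' hK]

/-! ### The two-sided bound -/

theorem theorem4p2 (η α C : ℝ) (σ : ℝ≥0) (hη : 0 < η) (hα : α ∈ Set.Ioo (1 / 2 : ℝ) 1)
    (hC : η⁻¹ < C) (hσ : 0 < σ) :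
    ∃ c₁ c₂ : ℝ, 0 < c₁ ∧ 0 < c₂ ∧
      ∀ (Ω : Type*) [MeasurableSpace Ω] (P : Measure Ω) [IsProbabilityMeasure P]
        (ξ : ℕ → Ω → ℝ),
        iIndepFun (fun i : ℕ => ξ (i + 1)) P →
        (∀ i : ℕ, 1 ≤ i → HasLaw (ξ i) (gaussianReal 0 σ) P) →
        ∀ n : ℕ, 2 ≤ n →
          Integrable (fun ω => (oracleEstimator (sgdIterate η α (fun i => ξ i ω))
            (batchSize C α) n - (σ : ℝ)) ^ 2) P ∧
          c₁ * ((n : ℝ) ^ (α - 1) * Real.log n) ≤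
            ∫ ω, (oracleEstimator (sgdIterate η α (fun i => ξ i ω))
              (batchSize C α) n - (σ : ℝ)) ^ 2 ∂P ∧
          ∫ ω, (oracleEstimator (sgdIterate η α (fun i => ξ i ω))
              (batchSize C α) n - (σ : ℝ)) ^ 2 ∂P ≤
            c₂ * ((n : ℝ) ^ (α - 1) * Real.log n) := by
  have hα0 : 0 < α := by linarith [hα.1]
  obtain ⟨c₁, hc₁, h1⟩ := exists_le_oracleMSE hη hα0 hα.2 ((inv_pos.2 hη).trans hC)
    (NNReal.coe_pos.2 hσ)
  obtain ⟨c₂, hc₂, h2⟩ := exists_oracleMSE_le (σ : ℝ) hη hα0 hα.2 hC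
  -- The constants precede the probability space because `oracleMSE` is deterministic.
  refine ⟨c₁, c₂, hc₁, hc₂, fun Ω _ P _ ξ hindep hlaw n hn => ?_⟩
  simp_rw [oracleEstimator_sgdIterate]
  obtain ⟨hint, hval⟩ := integral_sq_quadForm_sub hindep (fun i => hlaw (i + 1) (by omega))
    (Finset.range n) (fun a b => 1 / n * oracleForm (stepSize η α) (batchSize C α) n a b) σ
  rw [hval]
  exact ⟨hint, h1 n hn, h2 n hn⟩
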